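/- Let $\mathbb{C}^+$ be the open upper half-plane and let $\mathcal{H}$ be the set of analytic functions $f:\mathbb{C}^+\to\overline{\mathbb{C}^+}=\{w\in\mathbb{C}:\Im w\ge 0\}$. Every $f\in\mathcal{H}$ has a unique Nevanlinna representation $$f(z)=\alpha z+\beta+\int_{\mathbb{R}}\frac{1+zt}{t-z}\,d\rho(t),\qquad z\in\mathbb{C}^+,$$ with $\alpha\ge 0$, $\beta\in\mathbb{R}$ and $\rho$ a finite positive Borel measure on $\mathbb{R}$. Let $\sigma(f)\subset\mathbb{R}\cup\{\infty\}$ be the closed support of $\rho$, to which $\infty$ is added if $\alpha>0$ or the support is unbounded, and put $\Omega(f)=(\mathbb{R}\cup\{\infty\})\setminus\sigma(f)$. The same formula (with $f(\infty)=\beta-\int t\,d\rho(t)$ when $\infty\in\Omega(f)$) extends $f$ to a real-valued function on $\Omega(f)$; put $\Gamma(f)=\{x\in\Omega(f): f(x)<0\}$. For real $b,a$ with $b>a$ write $(b,a)=(b,\infty)\cup\{\infty\}\cup(-\infty,a)$. For a proper open interval $J=(b,a)$ of the circle $\mathbb{R}\cup\{\infty\}$ with distinct endpoints, let $p_J\in\mathcal{H}$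 be the conformal automorphism of $\mathbb{C}^+$ that is negative precisely on $J$ and satisfies $|p_J(i)|=1$; explicitly $$p_{(b,a)}(z)=\pm\frac{|i-b|}{|i-a|}\cdot\frac{z-a}{z-b}$$ for real $b\ne a$, with sign $+$ if $b<a$ and $-$ if $b>a$, while $p_{(-\infty,a)}(z)=(z-a)/|i-a|$ and $p_{(b,\infty)}(z)=-|i-b|/(z-b)$. If $J$ is the whole circle, or the circle with one point removed, put $p_J=-1$. The Kreĭn product of an open set $O\subset\mathbb{R}\cup\{\infty\}$ is $k_O=\prod_J p_J$, where $J$ runs over the connected components of $O$ (so $k_\varnothing=1$). The Lebesgue regularization of an open set $O\subset\mathbb{R}\cup\{\infty\}$ is the set of all $x\in\mathbb{R}\cup\{\infty\}$ having a neighbourhood $U$ in $\mathbb{R}\cup\{\infty\}$ such that $(U\setminus O)\cap\mathbb{R}$ has Lebesgue measure zero, and $O$ is Lebesgue regular if it equals its Lebesgue regularization. **Theorem.** Let $f\in\mathcal{H}$ be not identically zero. Then the product $k_{\Gamma(f)}$ converges unconditionally at every point of $\mathbb{C}^+$, $k_{\Gamma(f)}\in\mathcal{H}$, and there exists $g\in\mathcal{H}$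 such that $f=k_{\Gamma(f)}\,g$ on $\mathbb{C}^+$ and 1. $\sigma(g)\subset\sigma(f)$; 2. $g(x)>0$ for every $x\in\Omega(g)$; 3. the set $\Omega(g)$ is Lebesgue regular; 4. $\Omega(f)=\Omega(k_{\Gamma(f)})\cap\Omega(g)$. -/

import Mathlib

open MeasureTheory Set Filter Topology UpperHalfPlane
open scoped Manifold OnePoint

noncomputable section

namespace KreinFactorization

/-- The class `𝓗` of analytic functions from the open upper half-plane to its closure in `ℂ`. -/
def classH : Set (ℍ → ℂ) :=
  {f | MDifferentiable 𝓘(ℂ) 𝓘(ℂ) f ∧ ∀ z : ℍ, 0 ≤ (f z).im}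

/-! ### The Nevanlinna representation -/

/-- Data `(α, β, ρ)` with `α ≥ 0`, `β ∈ ℝ` and `ρ` a finite positive Borel measure on `ℝ`. -/
structure NevanlinnaTriple where
  α : ℝ
  β : ℝ
  ρ : Measure ℝ
  α_nonneg : 0 ≤ α
  isFiniteMeasure : IsFiniteMeasure ρ

instance : Inhabited NevanlinnaTriple := ⟨⟨0, 0, 0, le_rfl, inferInstance⟩⟩

/-- The triple represents `f` if
`f z = α z + β + ∫ (1 + z t) / (t - z) dρ(t)` for every `z` in the upper half-plane. -/
def NevanlinnaTriple.Represents (N : NevanlinnaTriple) (f : ℍ → ℂ) : Prop :=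
  ∀ z : ℍ, f z = N.α * (z : ℂ) + N.β + ∫ t : ℝ, (1 + (z : ℂ) * t) / (t - z) ∂N.ρ

/-- The Nevanlinna triple of `f`. By Nevanlinna's theorem every `f` in `𝓗` has exactly one
representing triple, so no choice is involved for the functions of the class. -/
def nevanlinna (f : ℍ → ℂ) : NevanlinnaTriple :=
  Classical.epsilon fun N => N.Represents f

/-- `σ(f)`: the closed support of `ρ`, together with `∞` if `α > 0` or the support is unbounded. -/
def sigma (f : ℍ → ℂ) : Set (OnePoint ℝ) :=
  ((↑) '' (nevanlinna f).ρ.support) ∪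
    {x | x = ∞ ∧ (0 < (nevanlinna f).α ∨ ¬ Bornology.IsBounded (nevanlinna f).ρ.support)}

/-- `Ω(f) = (ℝ ∪ {∞}) ∖ σ(f)`. -/
def Omega (f : ℍ → ℂ) : Set (OnePoint ℝ) := (sigma f)ᶜ

/-- The value at a point of `Ω(f)` of the analytic extension of `f`, given by the Nevanlinna
formula; at `∞` this is the limit `β - ∫ t dρ(t)` of that formula. (Only used on `Ω(f)`, where
the integrands are bounded on the support of `ρ`.) -/
def boundaryValue (f : ℍ → ℂ) : OnePoint ℝ → ℝ
  | ∞ => (nevanlinna f).β - ∫ t : ℝ, t ∂(nevanlinna f).ρ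
  | (x : ℝ) => (nevanlinna f).α * x + (nevanlinna f).β
      + ∫ t : ℝ, (1 + x * t) / (t - x) ∂(nevanlinna f).ρ

/-- `Γ(f) = {x ∈ Ω(f) : f(x) < 0}`. -/
def Gamma (f : ℍ → ℂ) : Set (OnePoint ℝ) := {x ∈ Omega f | boundaryValue f x < 0}

/-! ### Kreĭn products -/

/-- The open interval `(b, a)` of the circle `ℝ ∪ {∞}`. If `a < b` are real, it is
`(b, ∞) ∪ {∞} ∪ (-∞, a)`; the interval `(a, a)` is the complement of the point `a`. -/
def arc : OnePoint ℝ → OnePoint ℝ → Set (OnePoint ℝ)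
  | ∞, ∞ => {∞}ᶜ
  | ∞, (a : ℝ) => (↑) '' Iio a
  | (b : ℝ), ∞ => (↑) '' Ioi b
  | (b : ℝ), (a : ℝ) => if b < a then (↑) '' Ioo b a else ((↑) '' Icc a b)ᶜ

/-- The conformal automorphism `p_J`, `J = (b, a)`, which is negative precisely on `J` and has
`|p_J(i)| = 1`. For an interval `(a, a)` the formula gives the constant `-1`, like for the whole
circle, from which this interval differs by one point. -/
def factor : OnePoint ℝ → OnePoint ℝ → ℍ → ℂ
  | ∞, ∞, _ => -1
  | ∞, (a : ℝ), z => ((z : ℂ) - a) / ‖Complex.I - (a : ℂ)‖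
  | (b : ℝ), ∞, z => -(‖Complex.I - (b : ℂ)‖ / ((z : ℂ) - b))
  | (b : ℝ), (a : ℝ), z =>
      if b < a then
        ((‖Complex.I - (b : ℂ)‖ / ‖Complex.I - (a : ℂ)‖ : ℝ) : ℂ) * (((z : ℂ) - a) / ((z : ℂ) - b))
      else
        -(((‖Complex.I - (b : ℂ)‖ / ‖Complex.I - (a : ℂ)‖ : ℝ) : ℂ) *
          (((z : ℂ) - a) / ((z : ℂ) - b)))

/-- The pairs `(b, a)` of endpoints of the connected components of an open set `O` different from
the whole circle: the interval `(b, a)` is contained in `O`, and its endpoints are not in `O`. -/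
def components (O : Set (OnePoint ℝ)) : Set (OnePoint ℝ × OnePoint ℝ) :=
  {J | arc J.1 J.2 ⊆ O ∧ J.1 ∉ O ∧ J.2 ∉ O}

open scoped Classical in
/-- The Kreĭn product `k_O` of an open set `O ⊆ ℝ ∪ {∞}`: the product of the functions `p_J`, where
`J` runs over the connected components of `O`; it is `-1` if `O` is the whole circle. -/
def kreinProduct (O : Set (OnePoint ℝ)) (z : ℍ) : ℂ :=
  if O = univ then -1 else ∏' J : components O, factor J.1.1 J.1.2 z

/-! ### Lebesgue regular sets -/

/-- The Lebesgue regularization of `O`: the points with a neighbourhood that is contained in `O` up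
to a set of Lebesgue measure zero. -/
def lebesgueRegularization (O : Set (OnePoint ℝ)) : Set (OnePoint ℝ) :=
  {x | ∃ U ∈ 𝓝 x, volume (((↑) : ℝ → OnePoint ℝ) ⁻¹' (U \ O)) = 0}

/-- An open set is Lebesgue regular if it equals its Lebesgue regularization. -/
def IsLebesgueRegular (O : Set (OnePoint ℝ)) : Prop :=
  IsOpen O ∧ lebesgueRegularization O = O

end KreinFactorization

end

noncomputable section

namespace KreinFactorization

/-! ### The Herglotz representation in the unit disc -/

/-! The imaginary part of log f lies between 0 and π, so log f is again in the class. Since this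
imaginary part is bounded, a triple representing log f has α = 0 and an absolutely continuous
measure. Restricting that measure to the real points of Γ(f) and to their complement, and
exponentiating the two integrals, gives f = `negFactor` * `posFactor`. The first factor turns out to
be the Kreĭn product, the second is g.

To identify the first factor, log f is compared with iπ - log f. By `exists_complementary_measures`
there is one measure M such that G and iπ - G, for 0 ≤ Im G ≤ π, have representing measures with sum
M. On Γ(f) the imaginary part of log f tends to π, so the measure of iπ - log f vanishes there and
that of log f coincides with M. The same argument for a single factor shows that p_J is the
exponential of the integral of the kernel over J against M (`IsComplementary.factor_eq`). Countable
additivity over the components then gives `IsComplementary.kreinProduct_eq`. M is never computed,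
and uniqueness of the Nevanlinna representation is never used.

Boundary information comes from `NevanlinnaTriple.Represents.measure_eq_zero`: a representing
measure is null on any set where the imaginary part of the function tends to 0 vertically. Hence
`subset_Omega`, which recognizes points of Ω from limits alone. Positivity of g
(`boundaryValue_posFactor_pos`) holds because, where g is negative, `logPos` already uses up the
whole imaginary part π. Then `logNeg` has no mass there, f is negative there too, and log f would
have no mass at points where its imaginary part tends to π. Lebesgue regularity of Ω(g) follows from
positivity and absolute continuity. -/

/-- A bounded family of positive functionals on `C(X, ℝ)` converges along every ultrafilter to
integration against a finite measure. -/
theorem exists_measure_tendsto_of_ultrafilter {X ι : Type*} [TopologicalSpace X] [CompactSpace X]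
    [T2Space X] [MeasurableSpace X] [BorelSpace X] (𝓤 : Ultrafilter ι) (T : ι → C(X, ℝ) → ℝ)
    (hadd : ∀ i φ ψ, T i (φ + ψ) = T i φ + T i ψ) (hsmul : ∀ i (c : ℝ) φ, T i (c • φ) = c * T i φ)
    (hpos : ∀ i φ, 0 ≤ φ → 0 ≤ T i φ) {C : ℝ} (hC : ∀ i, T i 1 ≤ C) :
    ∃ μ : Measure X, IsFiniteMeasure μ ∧
      ∀ φ : C(X, ℝ), Tendsto (fun i => T i φ) 𝓤 (𝓝 (∫ x, φ x ∂μ)) := by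
  have hsub : ∀ i φ ψ, T i (φ - ψ) = T i φ - T i ψ := by
    intro i φ ψ
    have h := hadd i (φ - ψ) ψ
    rw [sub_add_cancel] at h
    linarith
  have hbd : ∀ i φ, T i φ ∈ Icc (-(‖φ‖ * C)) (‖φ‖ * C) := by
    intro i φ
    -- Positivity bounds the functional on φ by ‖φ‖ times its value at 1.
    have h1 : 0 ≤ T i (‖φ‖ • 1 - φ) := hpos _ _ fun x => by
      simpa using (le_abs_self _).trans (φ.norm_coe_le_norm x)
    have h2 : 0 ≤ T i (‖φ‖ • 1 + φ) := hpos _ _ fun x => by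
      have h3 := (neg_le_abs _).trans (φ.norm_coe_le_norm x)
      have h4 : 0 ≤ ‖φ‖ + φ x := by linarith
      simpa using h4
    rw [hsub, hsmul] at h1
    rw [hadd, hsmul] at h2
    have h3 := mul_le_mul_of_nonneg_left (hC i) (norm_nonneg φ)
    constructor <;> linarith
  -- Along an ultrafilter every bounded family converges, so a single limit process serves all φ at
  -- once and the limit is automatically linear.
  have hlim : ∀ φ, ∃ l, Tendsto (fun i => T i φ) 𝓤 (𝓝 l) := by
    intro φ
    obtain ⟨l, -, hl⟩ := (isCompact_Icc (a := -(‖φ‖ * C)) (b := ‖φ‖ * C)).ultrafilter_le_nhds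
      (𝓤.map fun i => T i φ) (by
        rw [le_principal_iff, Ultrafilter.mem_coe, Ultrafilter.mem_map]
        exact univ_mem' fun i => hbd i φ)
    exact ⟨l, hl⟩
  choose L hL using hlim
  let Λ : CompactlySupportedContinuousMap X ℝ →ₚ[ℝ] ℝ := PositiveLinearMap.mk₀
    { toFun := fun φ => L φ.toContinuousMap
      map_add' := fun φ ψ => tendsto_nhds_unique (hL _)
        (((hL φ.toContinuousMap).add (hL ψ.toContinuousMap)).congr fun i => (hadd i _ _).symm)
      map_smul' := fun c φ => tendsto_nhds_unique (hL _)
        (((hL φ.toContinuousMap).const_mul c).congr fun i => (hsmul i _ _).symm) }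
    fun φ hφ => ge_of_tendsto' (hL φ.toContinuousMap) fun i => hpos _ _ fun x => hφ x
  refine ⟨RealRMK.rieszMeasure Λ, inferInstance, fun φ => ?_⟩
  have h := RealRMK.integral_rieszMeasure Λ
    (CompactlySupportedContinuousMap.continuousMapEquiv φ)
  change ∫ x, φ x ∂(RealRMK.rieszMeasure Λ) = L φ at h
  rw [h]
  exact hL φ

/-- The parametrization of the unit circle by the angle. -/
def circlePoint (θ : ℝ) : Metric.sphere (0 : ℂ) 1 :=
  ⟨circleMap 0 1 θ, circleMap_mem_sphere 0 zero_le_one θ⟩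

theorem continuous_circlePoint : Continuous circlePoint :=
  (continuous_circleMap 0 1).subtype_mk _

/-- The mean of the product of `φ` and the values of `Re h` on the circle of radius `r`. -/
def radialMean (h : ℂ → ℂ) (r : ℝ) (φ : C(Metric.sphere (0 : ℂ) 1, ℝ)) : ℝ :=
  (2 * Real.pi)⁻¹ * ∫ θ in (0 : ℝ)..2 * Real.pi, φ (circlePoint θ) * (h (r * circleMap 0 1 θ)).re

theorem norm_mul_lt_one {r : ℝ} (hr : r ∈ Ioo (0 : ℝ) 1) {w : ℂ} (hw : ‖w‖ ≤ 1) :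
    ‖(r : ℂ) * w‖ < 1 := by
  rw [norm_mul, Complex.norm_real, Real.norm_of_nonneg hr.1.le]
  nlinarith [hr.1, hr.2, norm_nonneg w]

theorem diffContOnCl_comp_mul {h : ℂ → ℂ} (hh : DifferentiableOn ℂ h (Metric.ball 0 1)) {r : ℝ}
    (hr : r ∈ Ioo (0 : ℝ) 1) : DiffContOnCl ℂ (fun w => h (r * w)) (Metric.ball 0 1) := by
  apply DifferentiableOn.diffContOnCl
  rw [closure_ball _ one_ne_zero]
  refine hh.comp (by fun_prop) fun w hw => ?_
  rw [mem_closedBall_zero_iff] at hw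
  simpa using norm_mul_lt_one hr hw

theorem continuous_comp_circle {h : ℂ → ℂ} (hh : DifferentiableOn ℂ h (Metric.ball 0 1)) {r : ℝ}
    (hr : r ∈ Ioo (0 : ℝ) 1) : Continuous fun θ : ℝ => h (r * circleMap 0 1 θ) := by
  refine hh.continuousOn.comp_continuous (by fun_prop) fun θ => ?_
  rw [mem_ball_zero_iff]
  exact norm_mul_lt_one hr (by simp)

/-- The Schwarz integral formula. -/
theorem circleAverage_herglotz {h : ℂ → ℂ} (hh : DiffContOnCl ℂ h (Metric.ball 0 1)) {w : ℂ}
    (hw : ‖w‖ < 1) :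
    Real.circleAverage (fun ζ => (ζ + w) / (ζ - w) * ((h ζ).re : ℂ)) 0 1 =
      h w - Complex.I * (h 0).im := by
  have hw' : w ∈ Metric.ball (0 : ℂ) 1 := by simpa using hw
  have hne : ∀ ζ ∈ Metric.sphere (0 : ℂ) |1|, ζ - w ≠ 0 := by
    intro ζ hζ h0
    rw [abs_one, mem_sphere_zero_iff_norm, sub_eq_zero.1 h0] at hζ
    exact hw.ne hζ
  have hc : ContinuousOn h (Metric.sphere 0 |1|) := by
    rw [abs_one]
    exact hh.2.mono (Metric.sphere_subset_closedBall.trans_eq (closure_ball 0 one_ne_zero).symm)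
  have hcK : ContinuousOn (fun ζ : ℂ => (ζ + w) / (ζ - w)) (Metric.sphere 0 |1|) :=
    ContinuousOn.div (by fun_prop) (by fun_prop) hne
  have hcK1 : ContinuousOn (fun ζ : ℂ => (ζ - 0) / (ζ - w)) (Metric.sphere 0 |1|) :=
    ContinuousOn.div (by fun_prop) (by fun_prop) hne
  have hcR : ContinuousOn (fun ζ : ℂ => (((ζ + w) / (ζ - w)).re : ℂ)) (Metric.sphere 0 |1|) :=
    Complex.continuous_ofReal.comp_continuousOn (Complex.continuous_re.comp_continuousOn hcK)
  have hA : Real.circleAverage (fun ζ => (ζ + w) / (ζ - w) * h ζ) 0 1 = 2 * h w - h 0 := by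
    have h1 := DiffContOnCl.circleAverage_smul_div (R := 1) (c := 0) (by rwa [abs_one])
      (by rwa [abs_one]) (f := h) (w := w)
    have h2 := DiffContOnCl.circleAverage (R := 1) (c := 0) (f := h) (by rwa [abs_one])
    rw [← h1, ← h2]
    simp only [smul_eq_mul]
    have e1 := Real.circleAverage_fun_smul (𝕜 := ℂ) (a := 2) (c := 0) (R := 1)
      (f := fun ζ : ℂ => (ζ - 0) / (ζ - w) * h ζ)
    simp only [smul_eq_mul] at e1
    rw [← e1, ← Real.circleAverage_fun_sub]
    · refine Real.circleAverage_congr_sphere fun ζ hζ => ?_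
      have := hne ζ hζ
      field_simp
      ring
    · exact ContinuousOn.circleIntegrable' (continuousOn_const.mul (hcK1.mul hc))
    · exact ContinuousOn.circleIntegrable' hc
  have hB : Real.circleAverage (fun ζ => (((ζ + w) / (ζ - w)).re : ℂ) * h ζ) 0 1 = h w := by
    have := DiffContOnCl.circleAverage_re_herglotzRieszKernel_smul' hh hw'
    simpa using this
  -- Twice the real part of the kernel minus the kernel is its conjugate. Conjugating this average
  -- therefore gives the average of the kernel times the conjugate of h.
  have hD : Real.circleAverage
      (fun ζ => 2 * ((((ζ + w) / (ζ - w)).re : ℂ) * h ζ) - (ζ + w) / (ζ - w) * h ζ) 0 1 = h 0 := by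
    have e1 := Real.circleAverage_fun_smul (𝕜 := ℂ) (a := 2) (c := 0) (R := 1)
      (f := fun ζ : ℂ => (((ζ + w) / (ζ - w)).re : ℂ) * h ζ)
    simp only [smul_eq_mul] at e1
    rw [Real.circleAverage_fun_sub, e1, hB, hA]
    · ring
    · exact ContinuousOn.circleIntegrable' (continuousOn_const.mul (hcR.mul hc))
    · exact ContinuousOn.circleIntegrable' (hcK.mul hc)
  have hcD : ContinuousOn
      (fun ζ => 2 * ((((ζ + w) / (ζ - w)).re : ℂ) * h ζ) - (ζ + w) / (ζ - w) * h ζ)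
      (Metric.sphere 0 |1|) := (continuousOn_const.mul (hcR.mul hc)).sub (hcK.mul hc)
  have hE := (Complex.conjCLE : ℂ →L[ℝ] ℂ).circleAverage_comp_comm (c := 0) (R := 1)
    (ContinuousOn.circleIntegrable' hcD)
  rw [hD] at hE
  -- The kernel times Re h is half the sum of the kernel times h and the kernel times the conjugate
  -- of h; both averages are now known.
  have hF : Real.circleAverage (fun ζ => (1 / 2 : ℂ) • ((ζ + w) / (ζ - w) * h ζ +
      (((Complex.conjCLE : ℂ →L[ℝ] ℂ) : ℂ → ℂ) ∘ fun ζ => 2 * ((((ζ + w) / (ζ - w)).re : ℂ) * h ζ)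
        - (ζ + w) / (ζ - w) * h ζ) ζ)) 0 1 = h w - Complex.I * (h 0).im := by
    rw [Real.circleAverage_fun_smul, Real.circleAverage_fun_add, hE, hA]
    · apply Complex.ext <;> [simp; (simp; ring)]
    · exact ContinuousOn.circleIntegrable' (hcK.mul hc)
    · exact ContinuousOn.circleIntegrable'
        ((Complex.conjCLE : ℂ →L[ℝ] ℂ).continuous.comp_continuousOn hcD)
  rw [← hF]
  congr 1
  ext ζ
  simp only [Function.comp_apply]
  generalize (ζ + w) / (ζ - w) = K
  generalize h ζ = H
  apply Complex.ext <;> [simp; (simp; ring)]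

/-- The Herglotz representation of an analytic function with nonnegative real part in the unit
disc, with a measure obtained as a limit of radial means along an ultrafilter. -/
theorem exists_herglotz (𝓤 : Ultrafilter ℝ) (h𝓤 : (𝓤 : Filter ℝ) ≤ 𝓝[<] 1) {h : ℂ → ℂ}
    (hh : DifferentiableOn ℂ h (Metric.ball 0 1)) (hre : ∀ w, ‖w‖ < 1 → 0 ≤ (h w).re) :
    ∃ μ : Measure (Metric.sphere (0 : ℂ) 1), IsFiniteMeasure μ ∧
      (∀ φ : C(Metric.sphere (0 : ℂ) 1, ℝ),
        Tendsto (fun r => radialMean h r φ) 𝓤 (𝓝 (∫ ζ, φ ζ ∂μ))) ∧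
      ∀ w : ℂ, ‖w‖ < 1 →
        h w = Complex.I * (h 0).im + ∫ ζ, ((ζ : ℂ) + w) / (ζ - w) ∂μ := by
  classical
  have hev : ∀ᶠ r in (𝓤 : Filter ℝ), r ∈ Ioo (0 : ℝ) 1 := h𝓤 (Ioo_mem_nhdsLT zero_lt_one)
  have hcφ : ∀ φ : C(Metric.sphere (0 : ℂ) 1, ℝ), Continuous fun θ => φ (circlePoint θ) :=
    fun φ => φ.continuous.comp continuous_circlePoint
  have hcr : ∀ r ∈ Ioo (0 : ℝ) 1, Continuous fun θ : ℝ => (h (r * circleMap 0 1 θ)).re :=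
    fun r hr => Complex.continuous_re.comp (continuous_comp_circle hh hr)
  have key : ∀ r ∈ Ioo (0 : ℝ) 1, ∀ w : ℂ, ‖w‖ < 1 →
      (2 * Real.pi)⁻¹ • ∫ θ in (0 : ℝ)..2 * Real.pi, (circleMap 0 1 θ + w) / (circleMap 0 1 θ - w) *
        ((h (r * circleMap 0 1 θ)).re : ℂ) = h (r * w) - Complex.I * (h 0).im := by
    intro r hr w hw
    have := circleAverage_herglotz (diffContOnCl_comp_mul hh hr) hw
    rw [mul_zero] at this
    exact this
  -- The value 0 for other radii makes linearity and positivity hold for every r; the ultrafilter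
  -- does not see those radii. The mass bound is the mean value property at 0.
  obtain ⟨μ, hμ, hlim⟩ := exists_measure_tendsto_of_ultrafilter 𝓤
    (fun r φ => if r ∈ Ioo (0 : ℝ) 1 then radialMean h r φ else 0) (C := (h 0).re)
    (by
      intro r φ ψ
      split_ifs with hr
      · simp only [radialMean, ContinuousMap.add_apply, add_mul]
        rw [intervalIntegral.integral_add, mul_add]
        all_goals exact ((hcφ _).mul (hcr r hr)).intervalIntegrable _ _
      · simp)
    (by
      intro r c φ
      split_ifs with hr
      · simp only [radialMean, ContinuousMap.smul_apply, smul_eq_mul, mul_assoc]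
        rw [intervalIntegral.integral_const_mul]
        ring
      · simp)
    (by
      intro r φ hφ
      split_ifs with hr
      · refine mul_nonneg (by positivity)
          (intervalIntegral.integral_nonneg (by positivity) fun θ _ => ?_)
        exact mul_nonneg (hφ _) (hre _ (norm_mul_lt_one hr (by simp)))
      · exact le_rfl)
    (by
      intro r
      split_ifs with hr
      · have h1 := congrArg Complex.re (key r hr 0 (by simp))
        rw [Complex.smul_re] at h1
        have h2 : ∀ θ : ℝ, (circleMap 0 1 θ + 0) / (circleMap 0 1 θ - 0) *
            ((h (r * circleMap 0 1 θ)).re : ℂ) = ((h (r * circleMap 0 1 θ)).re : ℂ) := by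
          intro θ
          rw [add_zero, sub_zero, div_self (circleMap_ne_center one_ne_zero), one_mul]
        simp only [h2, intervalIntegral.integral_ofReal] at h1
        simp only [radialMean, ContinuousMap.one_apply, one_mul]
        simpa using h1.le
      · simpa using hre 0 (by simp))
  have hlim' : ∀ φ : C(Metric.sphere (0 : ℂ) 1, ℝ),
      Tendsto (fun r => radialMean h r φ) 𝓤 (𝓝 (∫ ζ, φ ζ ∂μ)) := fun φ =>
    (hlim φ).congr' (hev.mono fun r hr => if_pos hr)
  refine ⟨μ, hμ, hlim', fun w hw => ?_⟩
  have hcK : Continuous fun ζ : Metric.sphere (0 : ℂ) 1 => ((ζ : ℂ) + w) / (ζ - w) := by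
    refine Continuous.div (by fun_prop) (by fun_prop) fun ζ h0 => ?_
    have h1 := mem_sphere_zero_iff_norm.1 ζ.2
    rw [sub_eq_zero.1 h0] at h1
    exact hw.ne h1
  have hint : Integrable (fun ζ : Metric.sphere (0 : ℂ) 1 => ((ζ : ℂ) + w) / (ζ - w)) μ :=
    hcK.integrable_of_hasCompactSupport (HasCompactSupport.of_compactSpace _)
  have hw1 : Tendsto (fun r : ℝ => h (r * w) - Complex.I * (h 0).im) 𝓤
      (𝓝 (h w - Complex.I * (h 0).im)) := by
    refine Tendsto.sub_const ?_ _
    have h1 : ContinuousAt h w :=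
      (hh.differentiableAt (Metric.isOpen_ball.mem_nhds (by simpa using hw))).continuousAt
    refine h1.tendsto.comp ?_
    have h2 : Tendsto (fun r : ℝ => (r : ℂ) * w) (𝓝 1) (𝓝 w) := by
      have : Continuous fun r : ℝ => (r : ℂ) * w := by fun_prop
      simpa using this.tendsto 1
    exact h2.mono_left (h𝓤.trans nhdsWithin_le_nhds)
  have hcθ : Continuous fun θ : ℝ => (circleMap 0 1 θ + w) / (circleMap 0 1 θ - w) :=
    hcK.comp continuous_circlePoint
  -- The convergence is known for real test functions only, so the complex kernel is tested through
  -- real functionals, later the real and imaginary parts.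
  have hreal : ∀ L : ℂ →L[ℝ] ℝ, L (∫ ζ, ((ζ : ℂ) + w) / (ζ - w) ∂μ) =
      L (h w - Complex.I * (h 0).im) := by
    intro L
    rw [← L.integral_comp_comm hint]
    refine tendsto_nhds_unique (hlim' ⟨_, L.continuous.comp hcK⟩)
      (((L.continuous.tendsto _).comp hw1).congr' (hev.mono fun r hr => ?_))
    rw [Function.comp_apply, ← key r hr w hw, map_smul, ← L.intervalIntegral_comp_comm]
    · simp only [radialMean, smul_eq_mul, ContinuousMap.coe_mk, Function.comp_apply, circlePoint]
      congr 1
      refine intervalIntegral.integral_congr fun θ _ => ?_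
      rw [mul_comm _ ((h (r * circleMap 0 1 θ)).re : ℂ), ← Complex.real_smul, map_smul,
        smul_eq_mul, mul_comm]
    · exact (hcθ.mul (Complex.continuous_ofReal.comp (hcr r hr))).intervalIntegrable _ _
  have h3 : ∫ ζ, ((ζ : ℂ) + w) / (ζ - w) ∂μ = h w - Complex.I * (h 0).im :=
    Complex.ext (hreal Complex.reCLM) (hreal Complex.imCLM)
  rw [h3]
  ring

/-! ### The Nevanlinna representation in the upper half-plane -/

/-- The kernel of the Nevanlinna representation. -/
def kernel (z : ℂ) (t : ℝ) : ℂ := (1 + z * t) / (t - z)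

theorem ofReal_sub_ne_zero {z : ℂ} (hz : 0 < z.im) (t : ℝ) : (t : ℂ) - z ≠ 0 := by
  intro h
  have := congrArg Complex.im h
  simp at this
  exact hz.ne' this

theorem continuous_kernel {z : ℂ} (hz : 0 < z.im) : Continuous (kernel z) :=
  Continuous.div (by fun_prop) (by fun_prop) (ofReal_sub_ne_zero hz)

/-- The real number that the Cayley transform sends to the point `ζ` of the unit circle. -/
def realPoint (ζ : Metric.sphere (0 : ℂ) 1) : ℝ := (Complex.I * (1 + ζ) / (1 - ζ)).re

theorem measurable_realPoint : Measurable realPoint := by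
  unfold realPoint
  fun_prop

/-- The point `1` of the unit circle, which corresponds to `∞`. -/
def onePoint : Metric.sphere (0 : ℂ) 1 := ⟨1, by simp⟩

theorem one_sub_ne_zero {ζ : Metric.sphere (0 : ℂ) 1} (hζ : ζ ≠ onePoint) :
    (1 : ℂ) - ζ ≠ 0 := fun h => hζ (Subtype.ext (sub_eq_zero.1 h).symm)

theorem ofReal_realPoint {ζ : Metric.sphere (0 : ℂ) 1} (hζ : ζ ≠ onePoint) :
    (realPoint ζ : ℂ) = Complex.I * (1 + ζ) / (1 - ζ) := by
  have h1 := one_sub_ne_zero hζ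
  rw [realPoint, ← Complex.conj_eq_iff_re]
  have h2 : (ζ : ℂ) * (starRingEnd ℂ) ζ = 1 := by
    rw [Complex.mul_conj, Complex.normSq_eq_norm_sq, mem_sphere_zero_iff_norm.1 ζ.2]
    simp
  have h3 : (1 : ℂ) - (starRingEnd ℂ) ζ ≠ 0 := by
    intro h
    apply h1
    have := congrArg (starRingEnd ℂ) h
    simpa using this
  simp only [map_div₀, map_mul, map_add, map_sub, map_one, Complex.conj_I]
  rw [div_eq_div_iff h3 h1]
  linear_combination (2 * Complex.I) * h2

/-- The triple attached to a measure on the unit circle. -/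
def NevanlinnaTriple.ofCircle (μ : Measure (Metric.sphere (0 : ℂ) 1)) [IsFiniteMeasure μ] (β : ℝ) :
    NevanlinnaTriple where
  α := μ.real {onePoint}
  β := β
  -- The point 1 has to be removed first: division by zero makes `realPoint` send it to 0, whereas
  -- its atom belongs to `α`.
  ρ := (μ.restrict {onePoint}ᶜ).map realPoint
  α_nonneg := measureReal_nonneg
  isFiniteMeasure := inferInstance

theorem herglotz_kernel_eq {z : ℂ} (hz : 0 < z.im) {ζ : Metric.sphere (0 : ℂ) 1}
    (hζ : ζ ≠ onePoint) :
    ((ζ : ℂ) + (z - Complex.I) / (z + Complex.I)) / (ζ - (z - Complex.I) / (z + Complex.I)) =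
      -Complex.I * kernel z (realPoint ζ) := by
  have h1 := one_sub_ne_zero hζ
  have h2 : z + Complex.I ≠ 0 := by
    intro h
    have := congrArg Complex.im h
    simp at this
    linarith
  have h3 := ofReal_sub_ne_zero hz (realPoint ζ)
  have h4 : (ζ : ℂ) - (z - Complex.I) / (z + Complex.I) ≠ 0 := by
    intro h
    apply h3
    rw [ofReal_realPoint hζ]
    rw [sub_eq_zero, eq_div_iff h2] at h
    rw [sub_eq_zero, div_eq_iff h1]
    linear_combination h
  rw [kernel, ofReal_realPoint hζ] at *
  rw [← mul_div_assoc, div_eq_div_iff h4 h3]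
  field_simp
  ring_nf
  simp only [Complex.I_sq, show Complex.I ^ 3 = -Complex.I by rw [pow_succ, Complex.I_sq]; ring]
  ring

theorem norm_cayley_lt_one {z : ℂ} (hz : 0 < z.im) :
    ‖(z - Complex.I) / (z + Complex.I)‖ < 1 := by
  have h : ‖z - Complex.I‖ ^ 2 < ‖z + Complex.I‖ ^ 2 := by
    rw [← Complex.normSq_eq_norm_sq, ← Complex.normSq_eq_norm_sq, Complex.normSq_apply,
      Complex.normSq_apply]
    simp
    nlinarith
  have h1 : 0 ≤ ‖z - Complex.I‖ := norm_nonneg _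
  have h2 := abs_lt_of_sq_lt_sq h (norm_nonneg _)
  rw [abs_of_nonneg h1] at h2
  rw [norm_div, div_lt_one (h1.trans_lt h2)]
  exact h2

/-- The transfer to the disc of a function on the upper half-plane. -/
def discFunction (f : ℍ → ℂ) (w : ℂ) : ℂ :=
  -Complex.I * f (ofComplex (Complex.I * (1 + w) / (1 - w)))

theorem cayleyInv_im_pos {w : ℂ} (hw : ‖w‖ < 1) : 0 < (Complex.I * (1 + w) / (1 - w)).im := by
  have h1 : Complex.normSq (1 - w) ≠ 0 := by
    rw [Ne, Complex.normSq_eq_zero, sub_eq_zero]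
    rintro rfl
    simp at hw
  have h2 : w.re * w.re + w.im * w.im < 1 := by
    rw [← Complex.normSq_apply, Complex.normSq_eq_norm_sq]
    nlinarith [norm_nonneg w]
  have h3 : 0 < Complex.normSq (1 - w) := lt_of_le_of_ne (Complex.normSq_nonneg _) h1.symm
  have : (Complex.I * (1 + w) / (1 - w)).im =
      (1 - (w.re * w.re + w.im * w.im)) / Complex.normSq (1 - w) := by
    rw [Complex.div_im]
    simp
    field_simp
    ring
  rw [this]
  exact div_pos (by linarith) h3

theorem differentiableOn_discFunction {f : ℍ → ℂ} (hf : MDifferentiable 𝓘(ℂ) 𝓘(ℂ) f) :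
    DifferentiableOn ℂ (discFunction f) (Metric.ball 0 1) := by
  rw [mdifferentiable_iff] at hf
  have h1 : ∀ w ∈ Metric.ball (0 : ℂ) 1, 1 - w ≠ 0 := by
    intro w hw h
    rw [mem_ball_zero_iff, ← sub_eq_zero.1 h] at hw
    simp at hw
  refine DifferentiableOn.const_mul (hf.comp ?_ fun w hw => ?_) _
  · exact DifferentiableOn.div (by fun_prop) (by fun_prop) h1
  · exact cayleyInv_im_pos (mem_ball_zero_iff.1 hw)

/-- Under the Cayley transform the Herglotz kernel becomes -i times the Nevanlinna kernel away from
the point 1. At 1 it equals -iz, so the atom there produces the linear term. -/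
theorem represents_ofCircle {f : ℍ → ℂ} {μ : Measure (Metric.sphere (0 : ℂ) 1)} [IsFiniteMeasure μ]
    (h : ∀ w : ℂ, ‖w‖ < 1 → discFunction f w =
      Complex.I * (discFunction f 0).im + ∫ ζ, ((ζ : ℂ) + w) / (ζ - w) ∂μ) :
    (NevanlinnaTriple.ofCircle μ (-(discFunction f 0).im)).Represents f := by
  intro z
  have hz := z.im_pos
  have h2 : (z : ℂ) + Complex.I ≠ 0 := by
    intro h
    have := congrArg Complex.im h
    simp at this
    linarith
  set w := ((z : ℂ) - Complex.I) / (z + Complex.I) with hw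
  have hw1 : ‖w‖ < 1 := norm_cayley_lt_one hz
  have hw2 : Complex.I * (1 + w) / (1 - w) = z := by
    rw [hw]
    have : (1 : ℂ) - (z - Complex.I) / (z + Complex.I) ≠ 0 := by
      rw [one_sub_div h2]
      refine div_ne_zero ?_ h2
      simp
    field_simp
    ring
  have h3 := h w hw1
  have hcK : Continuous fun ζ : Metric.sphere (0 : ℂ) 1 => ((ζ : ℂ) + w) / (ζ - w) := by
    refine Continuous.div (by fun_prop) (by fun_prop) fun ζ h0 => ?_
    have h1 := mem_sphere_zero_iff_norm.1 ζ.2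
    rw [sub_eq_zero.1 h0] at h1
    exact hw1.ne h1
  have hint : Integrable (fun ζ : Metric.sphere (0 : ℂ) 1 => ((ζ : ℂ) + w) / (ζ - w)) μ :=
    hcK.integrable_of_hasCompactSupport (HasCompactSupport.of_compactSpace _)
  have h4 : ∫ ζ in {onePoint}ᶜ, ((ζ : ℂ) + w) / (ζ - w) ∂μ =
      -Complex.I * ∫ t, kernel z t ∂((μ.restrict {onePoint}ᶜ).map realPoint) := by
    rw [integral_map measurable_realPoint.aemeasurable
      (continuous_kernel hz).aestronglyMeasurable, ← integral_const_mul]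
    exact setIntegral_congr_fun (measurableSet_singleton _).compl
      fun ζ hζ => herglotz_kernel_eq hz hζ
  have h5 : ∫ ζ in {onePoint}, ((ζ : ℂ) + w) / (ζ - w) ∂μ =
      μ.real {onePoint} * (-Complex.I * z) := by
    rw [integral_singleton, Complex.real_smul]
    congr 1
    rw [← hw2]
    simp only [onePoint]
    rw [← mul_div_assoc, ← mul_assoc, neg_mul, Complex.I_mul_I, neg_neg, one_mul]
  rw [← integral_add_compl (measurableSet_singleton onePoint) hint, h4, h5] at h3
  have h6 : discFunction f w = -Complex.I * f z := by
    rw [discFunction, hw2, ofComplex_apply]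
  rw [h6] at h3
  change f z = ((μ.real {onePoint} : ℝ) : ℂ) * (z : ℂ) + ((-(discFunction f 0).im : ℝ) : ℂ) +
    ∫ t, kernel z t ∂((μ.restrict {onePoint}ᶜ).map realPoint)
  have h7 := congrArg (Complex.I * ·) h3
  push_cast
  linear_combination h7 + (f z - μ.real {onePoint} * (z : ℂ) + (discFunction f 0).im -
    ∫ t, kernel z t ∂((μ.restrict {onePoint}ᶜ).map realPoint)) * Complex.I_sq

theorem exists_ultrafilter_le_nhdsLT : ∃ 𝓤 : Ultrafilter ℝ, (𝓤 : Filter ℝ) ≤ 𝓝[<] 1 :=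
  Ultrafilter.exists_le _

theorem discFunction_re_nonneg {f : ℍ → ℂ} (hf : ∀ z : ℍ, 0 ≤ (f z).im) (w : ℂ) :
    0 ≤ (discFunction f w).re := by
  simpa [discFunction] using hf _

/-- Nevanlinna's theorem: every function of the class has a representing triple. -/
theorem exists_represents {f : ℍ → ℂ} (hf : f ∈ classH) : ∃ N : NevanlinnaTriple, N.Represents f := by
  obtain ⟨𝓤, h𝓤⟩ := exists_ultrafilter_le_nhdsLT
  obtain ⟨μ, hμ, -, h⟩ := exists_herglotz 𝓤 h𝓤 (differentiableOn_discFunction hf.1)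
    fun w _ => discFunction_re_nonneg hf.2 w
  exact ⟨_, represents_ofCircle h⟩

theorem represents_nevanlinna {f : ℍ → ℂ} (hf : f ∈ classH) : (nevanlinna f).Represents f :=
  Classical.epsilon_spec (exists_represents hf)

/-- There are representing measures of the functions `G` with `0 ≤ Im G ≤ π` such that the sum of
the measures of `G` and `iπ - G` is always the same. -/
theorem exists_complementary_measures : ∃ M : Measure ℝ, IsFiniteMeasure M ∧
    (∃ N : NevanlinnaTriple, N.Represents (fun _ => Complex.I * Real.pi) ∧ N.ρ = M) ∧
    ∀ G : ℍ → ℂ, MDifferentiable 𝓘(ℂ) 𝓘(ℂ) G → (∀ z, 0 ≤ (G z).im) → (∀ z, (G z).im ≤ Real.pi) →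
      ∃ N N' : NevanlinnaTriple, N.Represents G ∧
        N'.Represents (fun z => Complex.I * Real.pi - G z) ∧ N.ρ + N'.ρ = M := by
  obtain ⟨𝓤, h𝓤⟩ := exists_ultrafilter_le_nhdsLT
  have hc : MDifferentiable 𝓘(ℂ) 𝓘(ℂ) (fun _ : ℍ => Complex.I * Real.pi) := mdifferentiable_const
  have hcim : ∀ z : ℍ, 0 ≤ ((fun _ : ℍ => Complex.I * Real.pi) z).im := by
    intro z
    simpa using Real.pi_pos.le
  obtain ⟨μ, hμ, hlim, h⟩ := exists_herglotz 𝓤 h𝓤 (differentiableOn_discFunction hc)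
    fun w _ => discFunction_re_nonneg hcim w
  refine ⟨_, (NevanlinnaTriple.ofCircle μ _).isFiniteMeasure, ⟨_, represents_ofCircle h, rfl⟩, ?_⟩
  intro G hG h0 hpi
  have hG' : MDifferentiable 𝓘(ℂ) 𝓘(ℂ) (fun z => Complex.I * Real.pi - G z) := hc.sub hG
  obtain ⟨μ₁, hμ₁, hlim₁, h₁⟩ := exists_herglotz 𝓤 h𝓤 (differentiableOn_discFunction hG)
    fun w _ => discFunction_re_nonneg h0 w
  obtain ⟨μ₂, hμ₂, hlim₂, h₂⟩ := exists_herglotz 𝓤 h𝓤 (differentiableOn_discFunction hG')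
    fun w _ => discFunction_re_nonneg (fun z => by simpa using hpi z) w
  refine ⟨_, _, represents_ofCircle h₁, represents_ofCircle h₂, ?_⟩
  -- For each radius the two radial means add up exactly to that of iπ. Since all three measures are
  -- limits along the same ultrafilter, the limits add up as well.
  have hsum : μ₁ + μ₂ = μ := by
    refine ext_of_forall_integral_eq_of_IsFiniteMeasure fun φ => ?_
    rw [integral_add_measure (φ.integrable μ₁) (φ.integrable μ₂)]
    refine tendsto_nhds_unique ((hlim₁ φ.toContinuousMap).add (hlim₂ φ.toContinuousMap))
      ((hlim φ.toContinuousMap).congr' ?_)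
    filter_upwards [h𝓤 (Ioo_mem_nhdsLT zero_lt_one)] with r hr
    have hi : ∀ F : ℍ → ℂ, MDifferentiable 𝓘(ℂ) 𝓘(ℂ) F → IntervalIntegrable
        (fun θ => φ.toContinuousMap (circlePoint θ) *
          (discFunction F (r * circleMap 0 1 θ)).re) volume 0 (2 * Real.pi) := fun F hF =>
      ((φ.continuous.comp continuous_circlePoint).mul (Complex.continuous_re.comp
        (continuous_comp_circle (differentiableOn_discFunction hF) hr))).intervalIntegrable _ _
    rw [radialMean, radialMean, radialMean, ← mul_add,
      ← intervalIntegral.integral_add (hi _ hG) (hi _ hG')]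
    congr 1
    refine intervalIntegral.integral_congr fun θ _ => ?_
    simp only [discFunction, ← mul_add, ← Complex.add_re]
    rw [add_sub_cancel]
  change (μ₁.restrict {onePoint}ᶜ).map realPoint + (μ₂.restrict {onePoint}ᶜ).map realPoint =
    (μ.restrict {onePoint}ᶜ).map realPoint
  rw [← Measure.map_add _ _ measurable_realPoint, ← Measure.restrict_add, hsum]

/-! ### Boundary behaviour of a function given by a Nevanlinna triple -/

/-- Isolates the only singular term, so that estimates and differentiability reduce to those of the
Cauchy kernel. -/
theorem kernel_eq {z : ℂ} {t : ℝ} (h : (t : ℂ) - z ≠ 0) :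
    kernel z t = z + (1 + z ^ 2) * ((t : ℂ) - z)⁻¹ := by
  rw [kernel]
  field_simp
  ring

theorem norm_kernel_le {z : ℂ} {t d : ℝ} (hd : 0 < d) (h : d ≤ ‖(t : ℂ) - z‖) :
    ‖kernel z t‖ ≤ ‖z‖ + (1 + ‖z‖ ^ 2) / d := by
  have h1 : 0 < ‖(t : ℂ) - z‖ := hd.trans_le h
  rw [kernel_eq (norm_pos_iff.1 h1)]
  refine (norm_add_le _ _).trans (add_le_add le_rfl ?_)
  rw [norm_mul, norm_inv, ← div_eq_mul_inv]
  have h2 : ‖1 + z ^ 2‖ ≤ 1 + ‖z‖ ^ 2 := by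
    refine (norm_add_le _ _).trans ?_
    simp
  gcongr

theorem measurable_kernel (z : ℂ) : Measurable (kernel z) := by
  unfold kernel
  fun_prop

theorem im_le_norm_ofReal_sub (z : ℂ) (t : ℝ) : z.im ≤ ‖(t : ℂ) - z‖ := by
  have := Complex.abs_im_le_norm ((t : ℂ) - z)
  simp at this
  exact (le_abs_self _).trans this

theorem integrable_kernel (ν : Measure ℝ) [IsFiniteMeasure ν] {z : ℂ} (hz : 0 < z.im) :
    Integrable (kernel z) ν :=
  Integrable.of_bound (measurable_kernel z).aestronglyMeasurable _
    (ae_of_all _ fun t => norm_kernel_le hz (im_le_norm_ofReal_sub z t))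

theorem kernel_im (z : ℂ) (t : ℝ) :
    (kernel z t).im = z.im * (1 + t ^ 2) / Complex.normSq (t - z) := by
  rw [kernel, Complex.div_im]
  simp
  ring

theorem kernel_im_nonneg {z : ℂ} (hz : 0 ≤ z.im) (t : ℝ) : 0 ≤ (kernel z t).im := by
  rw [kernel_im]
  exact div_nonneg (by positivity) (Complex.normSq_nonneg _)

theorem kernel_I (t : ℝ) : kernel Complex.I t = Complex.I := by
  have h : (t : ℂ) - Complex.I ≠ 0 := ofReal_sub_ne_zero (by simp) t
  rw [kernel, div_eq_iff h]
  linear_combination Complex.I_sq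

theorem kernel_ofReal (x t : ℝ) : kernel x t = (((1 + x * t) / (t - x) : ℝ) : ℂ) := by
  simp [kernel]

theorem integral_kernel_ofReal (ν : Measure ℝ) (x : ℝ) :
    ∫ t, kernel x t ∂ν = ((∫ t, (1 + x * t) / (t - x) ∂ν : ℝ) : ℂ) := by
  simp only [kernel_ofReal, integral_complex_ofReal]

theorem integral_kernel_im (ν : Measure ℝ) [IsFiniteMeasure ν] {z : ℂ} (hz : 0 < z.im) :
    (∫ t, kernel z t ∂ν).im = ∫ t, (kernel z t).im ∂ν :=
  (Complex.imCLM.integral_comp_comm (integrable_kernel ν hz)).symm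

theorem differentiableAt_integral_kernel (ν : Measure ℝ) [IsFiniteMeasure ν] {z : ℂ}
    (hz : 0 < z.im) : DifferentiableAt ℂ (fun z => ∫ t, kernel z t ∂ν) z := by
  have hU : {w : ℂ | z.im / 2 < w.im} ∈ 𝓝 z :=
    (isOpen_lt continuous_const Complex.continuous_im).mem_nhds (by simp; linarith)
  have hpos : ∀ w ∈ {w : ℂ | z.im / 2 < w.im}, 0 < w.im := fun w hw => by
    have : z.im / 2 < w.im := hw
    linarith
  have hint : ∀ w : ℂ, 0 < w.im → Integrable (fun t : ℝ => ((t : ℂ) - w)⁻¹) ν := by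
    intro w hw
    refine Integrable.of_bound (C := w.im⁻¹) (by fun_prop) (ae_of_all _ fun t => ?_)
    rw [norm_inv]
    exact inv_anti₀ hw (im_le_norm_ofReal_sub w t)
  have h1 : DifferentiableAt ℂ (fun w => ∫ t : ℝ, ((t : ℂ) - w)⁻¹ ∂ν) z := by
    refine (hasDerivAt_integral_of_dominated_loc_of_deriv_le (bound := fun _ => ((z.im / 2) ^ 2)⁻¹)
      (F := fun w (t : ℝ) => ((t : ℂ) - w)⁻¹) (F' := fun w t => (((t : ℂ) - w) ^ 2)⁻¹) hU ?_ (hint z hz) ?_ ?_ (integrable_const _)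
      ?_).2.differentiableAt
    · exact Eventually.of_forall fun w => by fun_prop
    · fun_prop
    · refine ae_of_all _ fun t w hw => ?_
      rw [norm_inv, norm_pow]
      have h2 : z.im / 2 ≤ ‖(t : ℂ) - w‖ := (le_of_lt hw).trans (im_le_norm_ofReal_sub w t)
      gcongr
    · refine ae_of_all _ fun t w hw => ?_
      have h2 := ((hasDerivAt_id w).const_sub (t : ℂ)).fun_inv (ofReal_sub_ne_zero (hpos w hw) t)
      simpa using h2
  have h3 : (fun z => ∫ t, kernel z t ∂ν) =ᶠ[𝓝 z] fun w =>
      ν.real univ * w + (1 + w ^ 2) * ∫ t : ℝ, ((t : ℂ) - w)⁻¹ ∂ν := by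
    filter_upwards [hU] with w hw
    have h4 : ∀ t, kernel w t = w + (1 + w ^ 2) * ((t : ℂ) - w)⁻¹ := fun t =>
      kernel_eq (ofReal_sub_ne_zero (hpos w hw) t)
    simp only [h4]
    rw [integral_add (integrable_const _) ((hint w (hpos w hw)).const_mul _), integral_const,
      integral_const_mul, Complex.real_smul]
  refine DifferentiableAt.congr_of_eventuallyEq ?_ h3
  fun_prop

theorem tendsto_integral_kernel {ν : Measure ℝ} [IsFiniteMeasure ν] {V : Set ℝ} {x : ℝ}
    (hV : V ∈ 𝓝 x) (hν : ν V = 0) :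
    Tendsto (fun z => ∫ t, kernel z t ∂ν) (𝓝 (x : ℂ))
      (𝓝 ((∫ t, (1 + x * t) / (t - x) ∂ν : ℝ) : ℂ)) := by
  obtain ⟨δ, hδ, hball⟩ := Metric.mem_nhds_iff.1 hV
  have hae : ∀ᵐ t ∂ν, δ ≤ |t - x| := by
    have : ∀ᵐ t ∂ν, t ∉ V := measure_eq_zero_iff_ae_notMem.1 hν
    filter_upwards [this] with t ht
    by_contra! h
    exact ht (hball h)
  rw [← integral_kernel_ofReal]
  refine tendsto_integral_filter_of_dominated_convergence
    (fun _ => (|x| + δ / 2) + (1 + (|x| + δ / 2) ^ 2) / (δ / 2)) ?_ ?_ (integrable_const _) ?_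
  · exact Eventually.of_forall fun z => (measurable_kernel z).aestronglyMeasurable
  · filter_upwards [Metric.ball_mem_nhds (x : ℂ) (half_pos hδ)] with z hz
    rw [mem_ball_iff_norm] at hz
    filter_upwards [hae] with t ht
    have h1 : ‖(t : ℂ) - x‖ = |t - x| := by rw [← Complex.ofReal_sub, Complex.norm_real]; rfl
    have h2 : δ / 2 ≤ ‖(t : ℂ) - z‖ := by
      have := norm_sub_le_norm_sub_add_norm_sub (t : ℂ) z x
      linarith
    have h3 : ‖z‖ ≤ |x| + δ / 2 := by
      have := norm_le_norm_add_norm_sub' z (x : ℂ)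
      rw [Complex.norm_real, Real.norm_eq_abs] at this
      linarith
    refine (norm_kernel_le (half_pos hδ) h2).trans ?_
    gcongr
  · filter_upwards [hae] with t ht
    have : (t : ℂ) - x ≠ 0 := by
      rw [← Complex.ofReal_sub, Complex.ofReal_ne_zero]
      intro h
      rw [h, abs_zero] at ht
      linarith
    unfold kernel
    exact ContinuousAt.div (by fun_prop) (by fun_prop) this

theorem tendsto_integral_kernel_cobounded {ν : Measure ℝ} [IsFiniteMeasure ν] {R : ℝ}
    (hν : ν {t | R < |t|} = 0) :
    Tendsto (fun z => ∫ t, kernel z t ∂ν) (Bornology.cobounded ℂ)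
      (𝓝 ((-∫ t, t ∂ν : ℝ) : ℂ)) := by
  have hae : ∀ᵐ t ∂ν, |t| ≤ max R 0 := by
    have : ∀ᵐ t ∂ν, t ∉ {t | R < |t|} := measure_eq_zero_iff_ae_notMem.1 hν
    filter_upwards [this] with t ht
    exact (not_lt.1 ht).trans (le_max_left _ _)
  generalize max R 0 = S at hae
  rw [← integral_neg, ← integral_complex_ofReal]
  have : (Bornology.cobounded ℂ).IsCountablyGenerated := by
    rw [← comap_norm_atTop]
    infer_instance
  refine tendsto_integral_filter_of_dominated_convergence
    (fun _ => 2 * (1 + S)) ?_ ?_ (integrable_const _) ?_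
  · exact Eventually.of_forall fun z => (measurable_kernel z).aestronglyMeasurable
  -- If ‖z‖ > 2S + 1 then |t - z| ≥ ‖z‖ / 2, and the kernel is at most 2 (1 + ‖z‖ S) / ‖z‖ ≤ 2 (1 +
  -- S).
  · filter_upwards [(Metric.hasBasis_cobounded_compl_closedBall (0 : ℂ)).mem_of_mem
      (i := 2 * S + 1) trivial] with z hz
    rw [mem_compl_iff, mem_closedBall_zero_iff, not_le] at hz
    filter_upwards [hae] with t ht
    have hS : 0 ≤ S := (abs_nonneg t).trans ht
    have h1 : ‖z‖ / 2 ≤ ‖(t : ℂ) - z‖ := by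
      have := norm_sub_norm_le z (t : ℂ)
      rw [norm_sub_rev, Complex.norm_real, Real.norm_eq_abs] at this
      linarith
    have h2 : ‖1 + z * (t : ℂ)‖ ≤ 1 + ‖z‖ * S := by
      refine (norm_add_le _ _).trans ?_
      rw [norm_one, norm_mul, Complex.norm_real, Real.norm_eq_abs]
      gcongr
    rw [kernel, norm_div, div_le_iff₀ (by linarith)]
    refine h2.trans ?_
    nlinarith
  · refine ae_of_all _ fun t => ?_
    have h1 : Tendsto (fun z : ℂ => (z⁻¹ + t) / (t * z⁻¹ - 1)) (Bornology.cobounded ℂ)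
        (𝓝 ((0 + t) / (t * 0 - 1))) :=
      (tendsto_inv₀_cobounded.add_const _).div
        ((tendsto_inv₀_cobounded.const_mul _).sub_const _) (by simp)
    have h2 : ((0 : ℂ) + t) / (t * 0 - 1) = ((-t : ℝ) : ℂ) := by
      push_cast
      ring
    rw [h2] at h1
    refine h1.congr' ?_
    filter_upwards [(Metric.hasBasis_cobounded_compl_closedBall (0 : ℂ)).mem_of_mem
      (i := 0) trivial] with z hz
    have hz0 : z ≠ 0 := by
      rw [mem_compl_iff, mem_closedBall_zero_iff, not_le] at hz
      exact norm_pos_iff.1 hz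
    rw [kernel, ← mul_div_mul_left (z⁻¹ + (t : ℂ)) _ hz0]
    congr 1
    · field_simp
    · field_simp

/-! ### Vertical limits and bounds for representing measures -/

/-- The point `x + iε` of the upper half-plane. -/
def above (x ε : ℝ) : ℍ := ofComplex (x + ε * Complex.I)

theorem coe_above (x : ℝ) {ε : ℝ} (hε : 0 < ε) : (above x ε : ℂ) = x + ε * Complex.I := by
  rw [above, ofComplex_apply_of_im_pos (by simpa using hε)]

theorem above_im (x : ℝ) {ε : ℝ} (hε : 0 < ε) : (above x ε : ℂ).im = ε := by
  simp [coe_above x hε]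

theorem tendsto_above (x : ℝ) : Tendsto (fun ε => (above x ε : ℂ)) (𝓝[>] 0) (𝓝 (x : ℂ)) := by
  have h : Tendsto (fun ε : ℝ => (x : ℂ) + ε * Complex.I) (𝓝[>] 0) (𝓝 (x : ℂ)) := by
    have : Continuous fun ε : ℝ => (x : ℂ) + ε * Complex.I := by fun_prop
    simpa using (this.tendsto 0).mono_left nhdsWithin_le_nhds
  refine h.congr' ?_
  filter_upwards [self_mem_nhdsWithin] with ε hε
  exact (coe_above x hε).symm

theorem tendsto_above_atTop :
    Tendsto (fun y => (above 0 y : ℂ)) atTop (Bornology.cobounded ℂ) := by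
  rw [← tendsto_norm_atTop_iff_cobounded]
  refine tendsto_id.congr' ?_
  filter_upwards [eventually_gt_atTop 0] with y hy
  simp [coe_above 0 hy, abs_of_pos hy]

instance (N : NevanlinnaTriple) : IsFiniteMeasure N.ρ := N.isFiniteMeasure

/-- The triple with `α = 0`. -/
def NevanlinnaTriple.ofMeasure (β : ℝ) (ν : Measure ℝ) [IsFiniteMeasure ν] : NevanlinnaTriple :=
  ⟨0, β, ν, le_rfl, inferInstance⟩

namespace NevanlinnaTriple

variable {N : NevanlinnaTriple} {f : ℍ → ℂ}

theorem Represents.eq (h : N.Represents f) (z : ℍ) :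
    f z = N.α * (z : ℂ) + N.β + ∫ t, kernel z t ∂N.ρ := h z

theorem Represents.im_eq (h : N.Represents f) (z : ℍ) :
    (f z).im = N.α * (z : ℂ).im + ∫ t, (kernel z t).im ∂N.ρ := by
  rw [h.eq, Complex.add_im, integral_kernel_im _ z.im_pos]
  simp

theorem Represents.integral_le_im (h : N.Represents f) (z : ℍ) :
    ∫ t, (kernel z t).im ∂N.ρ ≤ (f z).im := by
  have := mul_nonneg N.α_nonneg z.im_pos.le
  rw [h.im_eq]
  change 0 ≤ N.α * (z : ℂ).im at this
  linarith

theorem Represents.mem_classH (h : N.Represents f) : f ∈ classH := by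
  constructor
  · rw [mdifferentiable_iff]
    intro z hz
    have h1 : DifferentiableAt ℂ (fun z : ℂ => N.α * z + N.β + ∫ t, kernel z t ∂N.ρ) z :=
      DifferentiableAt.add (by fun_prop) (differentiableAt_integral_kernel _ hz)
    refine (h1.congr_of_eventuallyEq ?_).differentiableWithinAt
    filter_upwards [isOpen_upperHalfPlaneSet.mem_nhds hz] with w hw
    rw [Function.comp_apply, h.eq, ofComplex_apply_of_im_pos hw]
  · intro z
    exact (integral_nonneg fun t => kernel_im_nonneg z.im_pos.le t).trans (h.integral_le_im z)

/-- At the point x + iε the imaginary part of the kernel is ε (1 + t²) / ((t - x)² + ε²), which is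
at least 1 / (2ε) when |t - x| ≤ ε. -/
theorem Represents.measureReal_closedBall_le (h : N.Represents f) (x : ℝ) {ε : ℝ} (hε : 0 < ε) :
    N.ρ.real (Metric.closedBall x ε) ≤ 2 * ε * (f (above x ε)).im := by
  have him := (above x ε).im_pos
  have h1 : ∫ t in Metric.closedBall x ε, (kernel (above x ε) t).im ∂N.ρ ≤ (f (above x ε)).im :=
    (setIntegral_le_integral (integrable_kernel N.ρ him).im
      (ae_of_all _ fun t => kernel_im_nonneg him.le t)).trans (h.integral_le_im _)
  have h2 : (2 * ε)⁻¹ * N.ρ.real (Metric.closedBall x ε) ≤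
      ∫ t in Metric.closedBall x ε, (kernel (above x ε) t).im ∂N.ρ := by
    refine setIntegral_ge_of_const_le_real measurableSet_closedBall (measure_ne_top _ _)
      (fun t ht => ?_) (integrable_kernel N.ρ him).im.integrableOn
    have h3 : Complex.normSq ((t : ℂ) - above x ε) = (t - x) ^ 2 + ε ^ 2 := by
      rw [coe_above x hε, Complex.normSq_apply]
      simp
      ring
    rw [kernel_im, h3, above_im x hε, inv_eq_one_div, div_le_div_iff₀ (by positivity)
      (by positivity)]
    have h4 : (t - x) ^ 2 ≤ ε ^ 2 := sq_le_sq' (by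
      have := abs_le.1 (Metric.mem_closedBall.1 ht); linarith [this.1]) (by
      have := abs_le.1 (Metric.mem_closedBall.1 ht); linarith [this.2])
    nlinarith [sq_nonneg t, sq_nonneg (ε * t)]
  have h5 := h2.trans h1
  rwa [inv_mul_le_iff₀ (by positivity)] at h5

/-- The ball estimate says that arbitrarily small balls around each point of s have mass at most c
times their length; Besicovitch differentiation passes from balls to s. -/
theorem Represents.measure_le (h : N.Represents f) {s : Set ℝ} {c : ℝ}
    (hs : ∀ x ∈ s, ∃ᶠ ε in 𝓝[>] 0, (f (above x ε)).im ≤ c) :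
    N.ρ s ≤ ENNReal.ofReal c * volume s := by
  have hfin : IsLocallyFiniteMeasure (ENNReal.ofReal c • (volume : Measure ℝ)) := by
    have : ENNReal.ofReal c • (volume : Measure ℝ) = c.toNNReal • volume := rfl
    rw [this]
    infer_instance
  have := (Besicovitch.vitaliFamily N.ρ).measure_le_of_frequently_le
    (ENNReal.ofReal c • volume) Measure.AbsolutelyContinuous.rfl s fun x hx => by
      refine (Besicovitch.tendsto_filterAt N.ρ x).frequently ?_
      refine ((hs x hx).and_eventually self_mem_nhdsWithin).mono ?_
      rintro ε ⟨h1, hε⟩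
      have hε : 0 < ε := hε
      rw [Measure.smul_apply, Real.volume_closedBall, smul_eq_mul, mul_comm,
        ← ENNReal.ofReal_mul (by positivity), ← ofReal_measureReal]
      refine ENNReal.ofReal_le_ofReal ((h.measureReal_closedBall_le x hε).trans ?_)
      gcongr
  simpa using this

/-- On a bounded piece the previous bound holds for every c > 0, and the length is finite, so c may
tend to 0. -/
theorem Represents.measure_eq_zero (h : N.Represents f) {s : Set ℝ}
    (hs : ∀ x ∈ s, Tendsto (fun ε => (f (above x ε)).im) (𝓝[>] 0) (𝓝 0)) : N.ρ s = 0 := by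
  have h1 : ∀ n : ℕ, N.ρ (s ∩ Metric.closedBall 0 n) = 0 := by
    intro n
    have h2 : ∀ c : ℝ, 0 < c →
        N.ρ (s ∩ Metric.closedBall 0 n) ≤ ENNReal.ofReal (c * (2 * n)) := by
      intro c hc
      have h3 := h.measure_le (s := s ∩ Metric.closedBall 0 n) (c := c) fun x hx =>
        ((hs x hx.1).eventually_le_const hc).frequently
      refine h3.trans ?_
      rw [ENNReal.ofReal_mul hc.le]
      gcongr
      exact (measure_mono inter_subset_right).trans_eq (Real.volume_closedBall _ _)
    have h4 : Tendsto (fun c : ℝ => ENNReal.ofReal (c * (2 * n))) (𝓝[>] 0) (𝓝 0) := by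
      have : Continuous fun c : ℝ => ENNReal.ofReal (c * (2 * n)) :=
        ENNReal.continuous_ofReal.comp (by fun_prop)
      simpa using (this.tendsto 0).mono_left nhdsWithin_le_nhds
    refine le_antisymm (ge_of_tendsto h4 ?_) zero_le
    filter_upwards [self_mem_nhdsWithin] with c hc using h2 c hc
  have h5 : s = ⋃ n : ℕ, s ∩ Metric.closedBall 0 n := by
    rw [← inter_iUnion, Metric.iUnion_closedBall_nat, inter_univ]
  rw [h5, measure_iUnion_null_iff]
  exact h1

theorem Represents.absolutelyContinuous (h : N.Represents f) {C : ℝ} (hC : ∀ z, (f z).im ≤ C) :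
    N.ρ ≪ volume := by
  intro s hs
  have := h.measure_le (s := s) (c := C) fun x _ => Frequently.of_forall fun ε => hC _
  rw [hs, mul_zero] at this
  exact le_antisymm this zero_le

/-- The integral has nonnegative imaginary part, so Im f(iy) ≥ αy, which is unbounded unless α = 0.
-/
theorem Represents.α_eq_zero (h : N.Represents f) {C : ℝ}
    (hC : ∀ᶠ y in atTop, (f (above 0 y)).im ≤ C) : N.α = 0 := by
  by_contra hα
  have hα' : 0 < N.α := lt_of_le_of_ne N.α_nonneg (Ne.symm hα)
  obtain ⟨y, hy, hy0, hyC⟩ := ((eventually_gt_atTop 0).and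
    ((eventually_gt_atTop (C / N.α)).and hC)).exists
  have h1 := h.im_eq (above 0 y)
  have h2 : 0 ≤ ∫ t, (kernel (above 0 y) t).im ∂N.ρ :=
    integral_nonneg fun t => kernel_im_nonneg (above 0 y).im_pos.le t
  rw [above_im 0 hy] at h1
  rw [div_lt_iff₀ hα'] at hy0
  linarith

/-! ### The Nevanlinna formula at real points and at infinity -/

variable (N) in
/-- The value of the Nevanlinna formula at a real point. -/
def realValue (x : ℝ) : ℝ := N.α * x + N.β + ∫ t, (1 + x * t) / (t - x) ∂N.ρ

theorem tendsto_formula {V : Set ℝ} {x : ℝ} (hV : V ∈ 𝓝 x) (hν : N.ρ V = 0) :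
    Tendsto (fun z : ℂ => N.α * z + N.β + ∫ t, kernel z t ∂N.ρ) (𝓝 (x : ℂ))
      (𝓝 (N.realValue x : ℂ)) := by
  have h1 : Continuous fun z : ℂ => N.α * z + N.β := by fun_prop
  have h2 := (h1.tendsto (x : ℂ)).add (tendsto_integral_kernel hV hν)
  simpa [realValue] using h2

theorem Represents.tendsto_above (h : N.Represents f) {V : Set ℝ} {x : ℝ} (hV : V ∈ 𝓝 x)
    (hν : N.ρ V = 0) :
    Tendsto (fun ε => f (above x ε)) (𝓝[>] 0) (𝓝 (N.realValue x : ℂ)) :=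
  ((tendsto_formula hV hν).comp (KreinFactorization.tendsto_above x)).congr fun _ => (h.eq _).symm

theorem continuousAt_realValue {V : Set ℝ} {x : ℝ} (hV : V ∈ 𝓝 x) (hν : N.ρ V = 0) :
    ContinuousAt N.realValue x := by
  have h1 := (Complex.continuous_re.tendsto _).comp
    ((tendsto_formula hV hν).comp (Complex.continuous_ofReal.tendsto x))
  refine h1.congr fun y => ?_
  simp only [Function.comp_apply, integral_kernel_ofReal, realValue]
  simp

theorem tendsto_formula_cobounded (hα : N.α = 0) {R : ℝ} (hν : N.ρ {t | R < |t|} = 0) :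
    Tendsto (fun z : ℂ => N.α * z + N.β + ∫ t, kernel z t ∂N.ρ) (Bornology.cobounded ℂ)
      (𝓝 ((N.β - ∫ t, t ∂N.ρ : ℝ) : ℂ)) := by
  have h2 := (tendsto_integral_kernel_cobounded hν).const_add (N.β : ℂ)
  simpa [hα, sub_eq_add_neg] using h2

theorem Represents.tendsto_above_atTop (h : N.Represents f) (hα : N.α = 0) {R : ℝ}
    (hν : N.ρ {t | R < |t|} = 0) :
    Tendsto (fun y => f (above 0 y)) atTop (𝓝 ((N.β - ∫ t, t ∂N.ρ : ℝ) : ℂ)) :=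
  ((tendsto_formula_cobounded hα hν).comp KreinFactorization.tendsto_above_atTop).congr
    fun _ => (h.eq _).symm

theorem tendsto_realValue_cobounded (hα : N.α = 0) {R : ℝ} (hν : N.ρ {t | R < |t|} = 0) :
    Tendsto N.realValue (Bornology.cobounded ℝ) (𝓝 (N.β - ∫ t, t ∂N.ρ)) := by
  have h0 : Tendsto (fun x : ℝ => (x : ℂ)) (Bornology.cobounded ℝ) (Bornology.cobounded ℂ) := by
    rw [← tendsto_norm_atTop_iff_cobounded]
    simp only [Complex.norm_real]
    exact tendsto_norm_cobounded_atTop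
  have h1 := (Complex.continuous_re.tendsto _).comp
    ((tendsto_formula_cobounded hα hν).comp h0)
  refine h1.congr fun y => ?_
  simp only [Function.comp_apply, integral_kernel_ofReal, realValue]
  simp

theorem integrable_realKernel {ν : Measure ℝ} [IsFiniteMeasure ν] {x d : ℝ} (hd : 0 < d)
    (h : ∀ᵐ t ∂ν, d ≤ |t - x|) : Integrable (fun t => (1 + x * t) / (t - x)) ν := by
  have h1 : Integrable (kernel x) ν := by
    refine Integrable.of_bound (measurable_kernel _).aestronglyMeasurable
      (‖(x : ℂ)‖ + (1 + ‖(x : ℂ)‖ ^ 2) / d) ?_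
    filter_upwards [h] with t ht
    refine norm_kernel_le hd ?_
    rwa [← Complex.ofReal_sub, Complex.norm_real]
  refine h1.re.congr (ae_of_all _ fun t => ?_)
  simp only [kernel_ofReal]
  exact RCLike.ofReal_re (K := ℂ) _

theorem integral_pos_of_ae_pos {ν : Measure ℝ} (hν : ν ≠ 0) {φ : ℝ → ℝ} (hi : Integrable φ ν)
    (hφ : ∀ᵐ t ∂ν, 0 < φ t) : 0 < ∫ t, φ t ∂ν := by
  have h0 : 0 ≤ᵐ[ν] φ := hφ.mono fun t ht => ht.le
  refine lt_of_le_of_ne (integral_nonneg_of_ae h0) fun h => hν ?_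
  have h1 := (integral_eq_zero_iff_of_nonneg_ae h0 hi).1 h.symm
  rw [← ae_eq_bot, ← eventually_false_iff_eq_bot]
  filter_upwards [hφ, h1] with t ht ht'
  exact ht.ne' ht'

/-- The difference of the kernels at y and x is (y - x)(1 + t²) / ((t - y)(t - x)). It is positive
because t, lying outside the gap, is on the same side of x and y. -/
theorem strictMonoOn_realValue (hN : N.α ≠ 0 ∨ N.ρ ≠ 0) {a b : ℝ} (hν : N.ρ (Ioo a b) = 0) :
    StrictMonoOn N.realValue (Ioo a b) := by
  intro x hx y hy hxy
  have hae : ∀ᵐ t ∂N.ρ, t ∉ Ioo a b := measure_eq_zero_iff_ae_notMem.1 hν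
  have key : ∀ u ∈ Ioo a b, Integrable (fun t => (1 + u * t) / (t - u)) N.ρ := by
    intro u hu
    refine integrable_realKernel (d := min (u - a) (b - u))
      (lt_min (sub_pos.2 hu.1) (sub_pos.2 hu.2)) ?_
    filter_upwards [hae] with t ht
    rcases le_or_gt t a with h | h
    · rw [abs_sub_comm]
      exact (min_le_left _ _).trans ((by linarith : u - a ≤ u - t).trans (le_abs_self _))
    · have h2 : b ≤ t := not_lt.1 fun h2 => ht ⟨h, h2⟩
      exact (min_le_right _ _).trans ((by linarith : b - u ≤ t - u).trans (le_abs_self _))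
  have hi := (key y hy).sub (key x hx)
  have hpos : ∀ᵐ t ∂N.ρ, 0 < (1 + y * t) / (t - y) - (1 + x * t) / (t - x) := by
    filter_upwards [hae] with t ht
    have h1 : 0 < (t - y) * (t - x) := by
      rcases le_or_gt t a with h | h
      · exact mul_pos_of_neg_of_neg (by linarith [hy.1]) (by linarith [hx.1])
      · have h2 : b ≤ t := not_lt.1 fun h2 => ht ⟨h, h2⟩
        exact mul_pos (by linarith [hy.2]) (by linarith [hx.2])
    have h2 : t - y ≠ 0 := left_ne_zero_of_mul h1.ne'
    have h3 : t - x ≠ 0 := right_ne_zero_of_mul h1.ne'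
    rw [div_sub_div _ _ h2 h3]
    refine div_pos ?_ h1
    nlinarith [mul_pos (sub_pos.2 hxy) (by positivity : 0 < 1 + t ^ 2)]
  have hsub : N.realValue y - N.realValue x = N.α * (y - x) +
      ∫ t, ((1 + y * t) / (t - y) - (1 + x * t) / (t - x)) ∂N.ρ := by
    rw [realValue, realValue, integral_sub (key y hy) (key x hx)]
    ring
  have h0 : 0 ≤ ∫ t, ((1 + y * t) / (t - y) - (1 + x * t) / (t - x)) ∂N.ρ :=
    integral_nonneg_of_ae (hpos.mono fun t ht => ht.le)
  have hα := N.α_nonneg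
  rcases hN with h | h
  · have := mul_pos (lt_of_le_of_ne hα h.symm) (sub_pos.2 hxy)
    linarith
  · have := integral_pos_of_ae_pos h hi hpos
    have h2 := mul_nonneg hα (sub_pos.2 hxy).le
    simp only [Pi.sub_apply] at this
    linarith

theorem exists_strictMonoOn_realValue (hN : N.α ≠ 0 ∨ N.ρ ≠ 0) {V : Set ℝ} {x : ℝ} (hV : V ∈ 𝓝 x)
    (hν : N.ρ V = 0) : ∃ δ > 0, Ioo (x - δ) (x + δ) ⊆ V ∧
      StrictMonoOn N.realValue (Ioo (x - δ) (x + δ)) := by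
  obtain ⟨δ, hδ, h⟩ := Metric.mem_nhds_iff.1 hV
  rw [Real.ball_eq_Ioo] at h
  exact ⟨δ, hδ, h, strictMonoOn_realValue hN (measure_mono_null h hν)⟩

/-- Monotonicity across ∞: the limit of the kernel exceeds its value at a large x by (1 + t²) / (x -
t) > 0. -/
theorem eventually_realValue_lt (hα : N.α = 0) (hN : N.ρ ≠ 0) {R : ℝ}
    (hν : N.ρ {t | R < |t|} = 0) :
    ∀ᶠ x in atTop, N.realValue x < N.β - ∫ t, t ∂N.ρ := by
  have hae : ∀ᵐ t ∂N.ρ, t ∉ {t | R < |t|} := measure_eq_zero_iff_ae_notMem.1 hν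
  filter_upwards [eventually_gt_atTop (R + 1)] with x hx
  have h1 : Integrable (fun t => (1 + x * t) / (t - x)) N.ρ := by
    refine integrable_realKernel one_pos ?_
    filter_upwards [hae] with t ht
    have h2 : t ≤ R := (le_abs_self t).trans (not_lt.1 ht)
    rw [abs_sub_comm]
    exact (by linarith : 1 ≤ x - t).trans (le_abs_self _)
  have h2 : Integrable (fun t : ℝ => t) N.ρ := by
    refine Integrable.of_bound measurable_id.aestronglyMeasurable R ?_
    filter_upwards [hae] with t ht using not_lt.1 ht
  have h3 : 0 < ∫ t, (-t - (1 + x * t) / (t - x)) ∂N.ρ := by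
    refine integral_pos_of_ae_pos hN (h2.neg.sub h1) ?_
    filter_upwards [hae] with t ht
    have h2 : t ≤ R := (le_abs_self t).trans (not_lt.1 ht)
    have h4 : 0 < x - t := by linarith
    have h5 : -t - (1 + x * t) / (t - x) = (1 + t ^ 2) / (x - t) := by
      have : t - x ≠ 0 := by linarith
      field_simp
      ring
    rw [h5]
    positivity
  have h4 : Integrable (fun t : ℝ => -t) N.ρ := h2.neg
  rw [integral_sub h4 h1, integral_neg] at h3
  rw [realValue, hα]
  linarith

end NevanlinnaTriple

open NevanlinnaTriple

/-! ### The set `Ω(f)` -/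

variable {f : ℍ → ℂ}

theorem coe_mem_Omega {x : ℝ} :
    (x : OnePoint ℝ) ∈ Omega f ↔ ∃ V ∈ 𝓝 x, (nevanlinna f).ρ V = 0 := by
  rw [← Measure.notMem_support_iff_exists]
  simp [Omega, sigma]

theorem preimage_Omega : ((↑) : ℝ → OnePoint ℝ) ⁻¹' Omega f = (nevanlinna f).ρ.supportᶜ := by
  ext x
  simp [Omega, sigma]

theorem measure_preimage_Omega : (nevanlinna f).ρ ((↑) ⁻¹' Omega f : Set ℝ) = 0 := by
  rw [preimage_Omega]
  exact Measure.measure_compl_support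

theorem infty_mem_Omega : ∞ ∈ Omega f ↔
    (nevanlinna f).α = 0 ∧ ∃ R, (nevanlinna f).ρ {t | R < |t|} = 0 := by
  have h1 : ∞ ∈ Omega f ↔
      (nevanlinna f).α ≤ 0 ∧ Bornology.IsBounded (nevanlinna f).ρ.support := by
    simp [Omega, sigma]
  rw [h1]
  refine and_congr ⟨fun h => le_antisymm h (nevanlinna f).α_nonneg, fun h => h.le⟩ ?_
  rw [isBounded_iff_forall_norm_le]
  refine exists_congr fun R => ⟨fun h => ?_, fun h => ?_⟩
  · refine measure_mono_null ?_ (Measure.measure_compl_support (μ := (nevanlinna f).ρ))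
    intro t ht hs
    exact absurd (h t hs) (not_le.2 ht)
  · intro t ht
    by_contra! hR
    exact Measure.subset_compl_support_of_isOpen
      (isOpen_lt continuous_const continuous_abs) h hR ht

theorem isOpen_Omega : IsOpen (Omega f) := by
  rw [OnePoint.isOpen_def, preimage_Omega]
  refine ⟨fun h => ?_, Measure.isClosed_support.isOpen_compl⟩
  rw [compl_compl]
  refine Metric.isCompact_of_isClosed_isBounded Measure.isClosed_support ?_
  simp only [Omega, sigma] at h
  simp at h
  exact h.2

theorem boundaryValue_coe (x : ℝ) : boundaryValue f x = (nevanlinna f).realValue x := rfl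

theorem boundaryValue_infty :
    boundaryValue f ∞ = (nevanlinna f).β - ∫ t, t ∂(nevanlinna f).ρ := rfl

theorem tendsto_boundaryValue (hf : f ∈ classH) {x : ℝ} (hx : (x : OnePoint ℝ) ∈ Omega f) :
    Tendsto (fun ε => f (above x ε)) (𝓝[>] 0) (𝓝 (boundaryValue f x : ℂ)) := by
  obtain ⟨V, hV, h⟩ := coe_mem_Omega.1 hx
  exact (represents_nevanlinna hf).tendsto_above hV h

theorem tendsto_boundaryValue_infty (hf : f ∈ classH) (hx : ∞ ∈ Omega f) :
    Tendsto (fun y => f (above 0 y)) atTop (𝓝 (boundaryValue f ∞ : ℂ)) := by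
  obtain ⟨hα, R, h⟩ := infty_mem_Omega.1 hx
  exact (represents_nevanlinna hf).tendsto_above_atTop hα h

theorem exists_preimage_infty {U : Set (OnePoint ℝ)} (hU : IsOpen U) (h : ∞ ∈ U) :
    ∃ R : ℝ, ∀ t : ℝ, R < |t| → (t : OnePoint ℝ) ∈ U := by
  have h1 := ((OnePoint.isOpen_def.1 hU).1 h).isBounded
  obtain ⟨R, hR⟩ := isBounded_iff_forall_norm_le.1 h1
  refine ⟨R, fun t ht => ?_⟩
  by_contra hn
  exact absurd (hR t hn) (not_le.2 ht)

/-- A criterion for an open set to be contained in `Ω(f)`. -/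
theorem subset_Omega (hf : f ∈ classH) {U : Set (OnePoint ℝ)} (hU : IsOpen U)
    (h1 : ∀ x : ℝ, (x : OnePoint ℝ) ∈ U →
      Tendsto (fun ε => (f (above x ε)).im) (𝓝[>] 0) (𝓝 0))
    (h2 : ∞ ∈ U → ∃ C : ℝ, ∀ᶠ y in atTop, (f (above 0 y)).im ≤ C) : U ⊆ Omega f := by
  -- This handles the support at once, also near ∞. At ∞ itself only `α = 0` remains, which is why a
  -- bounded imaginary part suffices in `h2`.
  have h3 : (nevanlinna f).ρ ((↑) ⁻¹' U) = 0 :=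
    (represents_nevanlinna hf).measure_eq_zero fun x hx => h1 x hx
  have h4 : IsOpen ((↑) ⁻¹' U : Set ℝ) := hU.preimage OnePoint.continuous_coe
  intro x hx
  induction x using OnePoint.rec with
  | infty =>
    obtain ⟨C, hC⟩ := h2 hx
    obtain ⟨R, hR⟩ := exists_preimage_infty hU hx
    exact infty_mem_Omega.2 ⟨(represents_nevanlinna hf).α_eq_zero hC,
      R, measure_mono_null (fun t ht => hR t ht) h3⟩
  | coe x => exact coe_mem_Omega.2 ⟨_, h4.mem_nhds hx, h3⟩

theorem isOpen_Gamma : IsOpen (Gamma f) := by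
  have h0 : IsOpen ((↑) ⁻¹' Gamma f : Set ℝ) := by
    rw [isOpen_iff_mem_nhds]
    rintro x ⟨hx, hx'⟩
    have h1 : ((↑) ⁻¹' Omega f : Set ℝ) ∈ 𝓝 x :=
      (isOpen_Omega.preimage OnePoint.continuous_coe).mem_nhds hx
    obtain ⟨V, hV, h⟩ := coe_mem_Omega.1 hx
    filter_upwards [h1, (continuousAt_realValue hV h).eventually_lt_const hx'] with y hy hy'
    exact ⟨hy, hy'⟩
  refine OnePoint.isOpen_def.2 ⟨fun h => ?_, h0⟩
  obtain ⟨hα, R, hR⟩ := infty_mem_Omega.1 h.1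
  obtain ⟨S, hS⟩ := exists_preimage_infty isOpen_Omega h.1
  refine Metric.isCompact_of_isClosed_isBounded h0.isClosed_compl ?_
  have h1 := (tendsto_realValue_cobounded hα hR).eventually_lt_const h.2
  have h2 : ∀ᶠ x : ℝ in Bornology.cobounded ℝ, S < |x| :=
    tendsto_norm_cobounded_atTop.eventually (eventually_gt_atTop S)
  rw [Bornology.isBounded_def, compl_compl]
  filter_upwards [h1, h2] with x hx hx'
  exact ⟨hS x hx', hx⟩

theorem Represents.eq_const {N : NevanlinnaTriple} (h : N.Represents f) (hα : N.α = 0)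
    (hρ : N.ρ = 0) (z : ℍ) : f z = N.β := by
  rw [h.eq, hα, hρ]
  simp

/-- If `f` is not identically zero and some value on `Ω(f)` is not positive, then some value at a
real point of `Ω(f)` is negative. -/
theorem exists_boundaryValue_neg (hf : f ∈ classH) (hf0 : f ≠ 0) {x : OnePoint ℝ} (hx : x ∈ Omega f)
    (h : boundaryValue f x ≤ 0) : ∃ y : ℝ, (y : OnePoint ℝ) ∈ Omega f ∧ boundaryValue f y < 0 := by
  by_cases hN : (nevanlinna f).α ≠ 0 ∨ (nevanlinna f).ρ ≠ 0
  · induction x using OnePoint.rec with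
    | infty =>
      obtain ⟨hα, R, hR⟩ := infty_mem_Omega.1 hx
      obtain ⟨S, hS⟩ := exists_preimage_infty isOpen_Omega hx
      obtain ⟨y, hy, hy'⟩ := ((eventually_realValue_lt hα (hN.resolve_left (not_not.2 hα)) hR).and
        (eventually_gt_atTop S)).exists
      exact ⟨y, hS y (hy'.trans_le (le_abs_self y)), hy.trans_le h⟩
    | coe x =>
      have hx' : ((↑) ⁻¹' Omega f : Set ℝ) ∈ 𝓝 x :=
        (isOpen_Omega.preimage OnePoint.continuous_coe).mem_nhds hx
      obtain ⟨δ, hδ, hsub, hmono⟩ :=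
        exists_strictMonoOn_realValue hN hx' measure_preimage_Omega
      -- A step to the left makes the value strictly smaller, hence negative.
      have h1 : x - δ / 2 ∈ Ioo (x - δ) (x + δ) := ⟨by linarith, by linarith⟩
      exact ⟨x - δ / 2, hsub h1, (hmono h1 ⟨by linarith, by linarith⟩ (by linarith)).trans_le h⟩
  · push Not at hN
    have h1 := Represents.eq_const (represents_nevanlinna hf) hN.1 hN.2
    have h2 : ∀ y : OnePoint ℝ, boundaryValue f y = (nevanlinna f).β := by
      intro y
      induction y using OnePoint.rec with
      | infty => simp [boundaryValue_infty, hN.2]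
      | coe y => simp [boundaryValue_coe, realValue, hN.1, hN.2]
    refine ⟨0, coe_mem_Omega.2 ⟨univ, univ_mem, by simp [hN.2]⟩, ?_⟩
    rw [h2] at h ⊢
    refine lt_of_le_of_ne h fun h3 => hf0 ?_
    ext z
    simp [h1 z, h3]

/-- Strict monotonicity isolates each zero from the zeros to its right, and a set of reals with this
property is countable. -/
theorem countable_zeros (hf : f ∈ classH) (hf0 : f ≠ 0) :
    {x : ℝ | (x : OnePoint ℝ) ∈ Omega f ∧ boundaryValue f x = 0}.Countable := by
  by_cases hN : (nevanlinna f).α ≠ 0 ∨ (nevanlinna f).ρ ≠ 0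
  · refine (countable_setOfPred_isolated_right_within
      (s := {x : ℝ | (x : OnePoint ℝ) ∈ Omega f ∧ boundaryValue f x = 0})).mono ?_
    rintro x ⟨hx, h⟩
    have hx' : ((↑) ⁻¹' Omega f : Set ℝ) ∈ 𝓝 x :=
      (isOpen_Omega.preimage OnePoint.continuous_coe).mem_nhds hx
    obtain ⟨δ, hδ, hsub, hmono⟩ := exists_strictMonoOn_realValue hN hx' measure_preimage_Omega
    refine ⟨⟨hx, h⟩, ?_⟩
    rw [← empty_mem_iff_bot]
    filter_upwards [self_mem_nhdsWithin, mem_nhdsWithin_of_mem_nhds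
      (Iio_mem_nhds (by linarith : x < x + δ))] with y ⟨⟨hy, hy0⟩, hy1⟩ hy2
    replace hy1 : x < y := hy1
    have := hmono ⟨by linarith, by linarith⟩ ⟨by linarith, hy2⟩ hy1
    rw [boundaryValue_coe] at h hy0
    rw [h, hy0] at this
    exact lt_irrefl _ this
  · push Not at hN
    convert countable_empty
    rw [eq_empty_iff_forall_notMem]
    rintro x ⟨hx, h⟩
    apply hf0
    ext z
    rw [Represents.eq_const (represents_nevanlinna hf) hN.1 hN.2 z]
    rw [boundaryValue_coe, realValue, hN.1, hN.2] at h
    simpa using h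

/-! ### Logarithms and exponentials of functions of the class -/

section LogExp

/-- The kernel has strictly positive imaginary part, so any mass of ρ or any α > 0 makes Im f
positive. Consequently a nonconstant f avoids the branch cut of the logarithm. -/
theorem im_pos_or_eq_const (hf : f ∈ classH) :
    (∀ z, 0 < (f z).im) ∨ ∃ c : ℝ, ∀ z, f z = c := by
  have h := represents_nevanlinna hf
  by_cases hN : (nevanlinna f).α ≠ 0 ∨ (nevanlinna f).ρ ≠ 0
  · left
    intro z
    rw [h.im_eq]
    have hz : 0 < (z : ℂ).im := z.im_pos
    have h0 : ∀ t, 0 < (kernel z t).im := fun t => by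
      rw [kernel_im]
      exact div_pos (by positivity) (Complex.normSq_pos.2 (ofReal_sub_ne_zero hz t))
    have h1 : 0 ≤ ∫ t, (kernel z t).im ∂(nevanlinna f).ρ := integral_nonneg fun t => (h0 t).le
    have h2 := mul_nonneg (nevanlinna f).α_nonneg hz.le
    rcases hN with hα | hρ
    · have := mul_pos (lt_of_le_of_ne (nevanlinna f).α_nonneg hα.symm) hz
      linarith
    · have := integral_pos_of_ae_pos hρ (integrable_kernel _ hz).im (ae_of_all _ h0)
      change 0 < ∫ t, (kernel z t).im ∂(nevanlinna f).ρ at this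
      linarith
  · push Not at hN
    exact Or.inr ⟨_, Represents.eq_const h hN.1 hN.2⟩

theorem ne_zero_of_mem_classH (hf : f ∈ classH) (hf0 : f ≠ 0) (z : ℍ) : f z ≠ 0 := by
  rcases im_pos_or_eq_const hf with h | ⟨c, h⟩
  · intro h0
    have := h z
    simp [h0] at this
  · intro h0
    rw [h z] at h0
    exact hf0 (funext fun w => by rw [h w, h0]; rfl)

theorem mdifferentiable_log (hf : f ∈ classH) :
    MDifferentiable 𝓘(ℂ) 𝓘(ℂ) fun z => Complex.log (f z) := by
  rcases im_pos_or_eq_const hf with h | ⟨c, h⟩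
  · have h1 := UpperHalfPlane.mdifferentiable_iff.1 hf.1
    refine UpperHalfPlane.mdifferentiable_iff.2 (h1.clog fun z _ => ?_)
    exact Complex.mem_slitPlane_iff.2 (Or.inr (h _).ne')
  · simp only [h]
    exact mdifferentiable_const

theorem log_im_nonneg (hf : f ∈ classH) (z : ℍ) : 0 ≤ (Complex.log (f z)).im := by
  rw [Complex.log_im]
  exact Complex.arg_nonneg_iff.2 (hf.2 z)

theorem log_im_le_pi (z : ℍ) : (Complex.log (f z)).im ≤ Real.pi := by
  rw [Complex.log_im]
  exact Complex.arg_le_pi _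

theorem tendsto_log_im_of_pos {ι : Type*} {l : Filter ι} {u : ι → ℂ} {c : ℝ} (hc : 0 < c)
    (hu : Tendsto u l (𝓝 (c : ℂ))) : Tendsto (fun i => (Complex.log (u i)).im) l (𝓝 0) := by
  have h1 : ContinuousAt Complex.arg (c : ℂ) :=
    Complex.continuousAt_arg (Complex.ofReal_mem_slitPlane.2 hc)
  have h2 := h1.tendsto.comp hu
  rw [Complex.arg_ofReal_of_nonneg hc.le] at h2
  simpa only [Complex.log_im, Function.comp_def] using h2

/-- The argument jumps across the negative axis but is continuous there from the closed upper
half-plane, where `u` takes its values. -/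
theorem tendsto_log_im_of_neg {ι : Type*} {l : Filter ι} {u : ι → ℂ} {c : ℝ} (hc : c < 0)
    (hu : Tendsto u l (𝓝 (c : ℂ))) (him : ∀ i, 0 ≤ (u i).im) :
    Tendsto (fun i => (Complex.log (u i)).im) l (𝓝 Real.pi) := by
  have h1 : ContinuousWithinAt Complex.arg {z : ℂ | 0 ≤ z.im} (c : ℂ) :=
    Complex.continuousWithinAt_arg_of_re_neg_of_im_zero (by simpa using hc) (by simp)
  have h2 := h1.tendsto.comp
    (tendsto_nhdsWithin_of_tendsto_nhds_of_eventually_within _ hu (Eventually.of_forall him))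
  rw [Complex.arg_ofReal_of_neg hc] at h2
  simpa only [Complex.log_im, Function.comp_def] using h2

theorem exp_mem_classH {L : ℍ → ℂ} (hL : L ∈ classH) (hpi : ∀ z, (L z).im ≤ Real.pi) :
    (fun z => Complex.exp (L z)) ∈ classH := by
  constructor
  · exact UpperHalfPlane.mdifferentiable_iff.2 (UpperHalfPlane.mdifferentiable_iff.1 hL.1).cexp
  · intro z
    rw [Complex.exp_im]
    exact mul_nonneg (Real.exp_pos _).le (Real.sin_nonneg_of_nonneg_of_le_pi (hL.2 z) (hpi z))

theorem im_tendsto_zero {ι : Type*} {l : Filter ι} {u : ι → ℂ} {c : ℝ}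
    (hu : Tendsto u l (𝓝 (c : ℂ))) : Tendsto (fun i => (u i).im) l (𝓝 0) := by
  simpa [Function.comp_def] using (Complex.continuous_im.tendsto _).comp hu

theorem exists_eventually_im_le {l : Filter ℝ} {u : ℝ → ℂ} {c : ℂ} (hu : Tendsto u l (𝓝 c)) :
    ∃ C : ℝ, ∀ᶠ y in l, (u y).im ≤ C :=
  ⟨c.im + 1, ((Complex.continuous_im.tendsto _).comp hu).eventually_le_const (lt_add_one _)⟩

variable {N : NevanlinnaTriple} {L : ℍ → ℂ}

theorem tendsto_exp_above (hN : N.Represents L) {V : Set ℝ} (hV : IsOpen V) (hν : N.ρ V = 0) {x : ℝ}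
    (hx : x ∈ V) : ∃ c : ℝ, 0 < c ∧
      Tendsto (fun ε => Complex.exp (L (above x ε))) (𝓝[>] 0) (𝓝 (c : ℂ)) := by
  refine ⟨_, Real.exp_pos (N.realValue x), ?_⟩
  rw [Complex.ofReal_exp]
  exact (Complex.continuous_exp.tendsto _).comp (hN.tendsto_above (hV.mem_nhds hx) hν)

theorem tendsto_exp_above_atTop (hN : N.Represents L) (hα : N.α = 0) {U : Set (OnePoint ℝ)}
    (hU : IsOpen U) (hν : N.ρ ((↑) ⁻¹' U) = 0) (h : ∞ ∈ U) : ∃ c : ℝ, 0 < c ∧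
      Tendsto (fun y => Complex.exp (L (above 0 y))) atTop (𝓝 (c : ℂ)) := by
  obtain ⟨R, hR⟩ := exists_preimage_infty hU h
  refine ⟨_, Real.exp_pos (N.β - ∫ t, t ∂N.ρ), ?_⟩
  rw [Complex.ofReal_exp]
  exact (Complex.continuous_exp.tendsto _).comp
    (hN.tendsto_above_atTop hα (measure_mono_null (fun t ht => hR t ht) hν))

theorem subset_Omega_exp (hN : N.Represents L) (hα : N.α = 0) (hpi : ∀ z, (L z).im ≤ Real.pi)
    {U : Set (OnePoint ℝ)} (hU : IsOpen U) (hν : N.ρ ((↑) ⁻¹' U) = 0) :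
    U ⊆ Omega fun z => Complex.exp (L z) := by
  refine subset_Omega (exp_mem_classH hN.mem_classH hpi) hU (fun x hx => ?_) fun h => ?_
  · obtain ⟨c, -, hc⟩ := tendsto_exp_above hN (hU.preimage OnePoint.continuous_coe) hν hx
    exact im_tendsto_zero hc
  · obtain ⟨c, -, hc⟩ := tendsto_exp_above_atTop hN hα hU hν h
    exact exists_eventually_im_le hc

end LogExp

/-! ### The factors given by the parts of the representing measure of `log f` -/

section Parts

variable {N N' : NevanlinnaTriple}

/-- The set of the real points of `Γ(f)`. -/
def realGamma (f : ℍ → ℂ) : Set ℝ := (↑) ⁻¹' Gamma f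

theorem isOpen_realGamma : IsOpen (realGamma f) := isOpen_Gamma.preimage OnePoint.continuous_coe

/-- The part of `log f` that comes from the points where `f` is negative. -/
def logNeg (f : ℍ → ℂ) (N : NevanlinnaTriple) (z : ℍ) : ℂ :=
  ∫ t in realGamma f, kernel z t ∂N.ρ

/-- The other part of `log f`. -/
def logPos (f : ℍ → ℂ) (N : NevanlinnaTriple) (z : ℍ) : ℂ :=
  N.β + ∫ t in (realGamma f)ᶜ, kernel z t ∂N.ρ

theorem represents_logNeg : (ofMeasure 0 (N.ρ.restrict (realGamma f))).Represents (logNeg f N) := by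
  intro z
  simp only [logNeg, ofMeasure, Complex.ofReal_zero, zero_mul, zero_add]
  rfl

theorem represents_logPos :
    (ofMeasure N.β (N.ρ.restrict (realGamma f)ᶜ)).Represents (logPos f N) := by
  intro z
  simp only [logPos, ofMeasure, Complex.ofReal_zero, zero_mul, zero_add]
  rfl

theorem logNeg_im_nonneg (z : ℍ) : 0 ≤ (logNeg f N z).im := represents_logNeg.mem_classH.2 z

theorem logPos_im_nonneg (z : ℍ) : 0 ≤ (logPos f N z).im := represents_logPos.mem_classH.2 z

theorem α_eq_zero_of_represents_log (hN : N.Represents fun z => Complex.log (f z)) : N.α = 0 :=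
  hN.α_eq_zero (C := Real.pi) (Eventually.of_forall fun _ => log_im_le_pi _)

theorem logNeg_add_logPos (hN : N.Represents fun z => Complex.log (f z)) (z : ℍ) :
    logNeg f N z + logPos f N z = Complex.log (f z) := by
  have h1 := hN.eq z
  rw [h1, α_eq_zero_of_represents_log hN, logNeg, logPos,
    ← integral_add_compl isOpen_realGamma.measurableSet (integrable_kernel N.ρ z.im_pos)]
  simp only [Complex.ofReal_zero, zero_mul, zero_add]
  ring

theorem logNeg_im_add_logPos_im_le (hN : N.Represents fun z => Complex.log (f z)) (z : ℍ) :
    (logNeg f N z).im + (logPos f N z).im ≤ Real.pi := by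
  rw [← Complex.add_im, logNeg_add_logPos hN]
  exact log_im_le_pi z

theorem logNeg_im_le (hN : N.Represents fun z => Complex.log (f z)) (z : ℍ) :
    (logNeg f N z).im ≤ Real.pi := by
  linarith [logNeg_im_add_logPos_im_le hN z, logPos_im_nonneg (f := f) (N := N) z]

theorem logPos_im_le (hN : N.Represents fun z => Complex.log (f z)) (z : ℍ) :
    (logPos f N z).im ≤ Real.pi := by
  linarith [logNeg_im_add_logPos_im_le hN z, logNeg_im_nonneg (f := f) (N := N) z]

/-- The factor of `f` that comes from the points where `f` is negative. -/
def negFactor (f : ℍ → ℂ) (N : NevanlinnaTriple) (z : ℍ) : ℂ := Complex.exp (logNeg f N z)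

/-- The other factor of `f`. -/
def posFactor (f : ℍ → ℂ) (N : NevanlinnaTriple) (z : ℍ) : ℂ := Complex.exp (logPos f N z)

theorem negFactor_mem_classH (hN : N.Represents fun z => Complex.log (f z))
    : negFactor f N ∈ classH :=
  exp_mem_classH represents_logNeg.mem_classH (logNeg_im_le hN)

theorem posFactor_mem_classH (hN : N.Represents fun z => Complex.log (f z))
    : posFactor f N ∈ classH :=
  exp_mem_classH represents_logPos.mem_classH (logPos_im_le hN)

theorem eq_negFactor_mul_posFactor (hf : f ∈ classH) (hf0 : f ≠ 0)
    (hN : N.Represents fun z => Complex.log (f z))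
    (z : ℍ) : f z = negFactor f N z * posFactor f N z := by
  rw [negFactor, posFactor, ← Complex.exp_add, logNeg_add_logPos hN,
    Complex.exp_log (ne_zero_of_mem_classH hf hf0 z)]

/-- Where f is positive the argument of f tends to 0. The zeros of f are countable, hence null by
absolute continuity. -/
theorem measure_nonneg_part_eq_zero (hf : f ∈ classH) (hf0 : f ≠ 0)
    (hN : N.Represents fun z => Complex.log (f z)) :
    N.ρ (((↑) ⁻¹' Omega f : Set ℝ) \ realGamma f) = 0 := by
  have h1 : N.ρ {x : ℝ | (x : OnePoint ℝ) ∈ Omega f ∧ 0 < boundaryValue f x} = 0 :=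
    hN.measure_eq_zero fun x hx => tendsto_log_im_of_pos hx.2 (tendsto_boundaryValue hf hx.1)
  have h2 : N.ρ {x : ℝ | (x : OnePoint ℝ) ∈ Omega f ∧ boundaryValue f x = 0} = 0 :=
    hN.absolutelyContinuous (fun z => log_im_le_pi z) ((countable_zeros hf hf0).measure_zero _)
  refine measure_mono_null (fun x hx => ?_) (measure_union_null h1 h2)
  have h3 : 0 ≤ boundaryValue f x := not_lt.1 fun h => hx.2 ⟨hx.1, h⟩
  rcases h3.lt_or_eq with h | h
  · exact Or.inl ⟨hx.1, h⟩
  · exact Or.inr ⟨hx.1, h.symm⟩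

theorem measure_restrict_Omega (hf : f ∈ classH) (hf0 : f ≠ 0)
    (hN : N.Represents fun z => Complex.log (f z))
    :
    (ofMeasure N.β (N.ρ.restrict (realGamma f)ᶜ)).ρ ((↑) ⁻¹' Omega f : Set ℝ) = 0 := by
  change N.ρ.restrict (realGamma f)ᶜ _ = 0
  rw [Measure.restrict_apply (isOpen_Omega.preimage OnePoint.continuous_coe).measurableSet]
  exact measure_nonneg_part_eq_zero hf hf0 hN

theorem Omega_subset_Omega_posFactor (hf : f ∈ classH) (hf0 : f ≠ 0)
    (hN : N.Represents fun z => Complex.log (f z))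
    : Omega f ⊆ Omega (posFactor f N) :=
  subset_Omega_exp represents_logPos rfl (logPos_im_le hN) isOpen_Omega
    (measure_restrict_Omega hf hf0 hN)

/-- `subset_Omega_exp` is not available, since `logNeg` may have mass on Γ(f). Instead the factor is
the quotient of f by `posFactor`, whose limits on Ω(f) are positive. -/
theorem Omega_subset_Omega_negFactor (hf : f ∈ classH) (hf0 : f ≠ 0)
    (hN : N.Represents fun z => Complex.log (f z))
    : Omega f ⊆ Omega (negFactor f N) := by
  have hdiv : ∀ z, negFactor f N z = f z / posFactor f N z := fun z => by
    rw [eq_div_iff (show posFactor f N z ≠ 0 from Complex.exp_ne_zero _), ← eq_negFactor_mul_posFactor hf hf0 hN]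
  refine subset_Omega (negFactor_mem_classH hN) isOpen_Omega (fun x hx => ?_) fun h => ?_
  · obtain ⟨c, hc0, hc⟩ := tendsto_exp_above represents_logPos
      (isOpen_Omega.preimage OnePoint.continuous_coe) (measure_restrict_Omega hf hf0 hN) hx
    have h1 := (tendsto_boundaryValue hf hx).div hc (by exact_mod_cast hc0.ne')
    rw [← Complex.ofReal_div] at h1
    exact (im_tendsto_zero h1).congr fun ε => by rw [hdiv]; rfl
  · obtain ⟨c, hc0, hc⟩ := tendsto_exp_above_atTop represents_logPos rfl
      isOpen_Omega (measure_restrict_Omega hf hf0 hN) h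
    have h1 := (tendsto_boundaryValue_infty hf h).div hc (by exact_mod_cast hc0.ne')
    obtain ⟨C, hC⟩ := exists_eventually_im_le h1
    exact ⟨C, hC.mono fun y hy => by rw [hdiv]; exact hy⟩

theorem Omega_eq_inter (hf : f ∈ classH) (hf0 : f ≠ 0)
    (hN : N.Represents fun z => Complex.log (f z))
    : Omega f = Omega (negFactor f N) ∩ Omega (posFactor f N) := by
  refine Subset.antisymm (subset_inter (Omega_subset_Omega_negFactor hf hf0 hN)
    (Omega_subset_Omega_posFactor hf hf0 hN)) ?_
  refine subset_Omega hf (isOpen_Omega.inter isOpen_Omega) (fun x hx => ?_) fun h => ?_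
  · have h1 := (tendsto_boundaryValue (negFactor_mem_classH hN) hx.1).mul
      (tendsto_boundaryValue (posFactor_mem_classH hN) hx.2)
    rw [← Complex.ofReal_mul] at h1
    exact (im_tendsto_zero h1).congr fun ε => by rw [eq_negFactor_mul_posFactor hf hf0 hN]
  · have h1 := (tendsto_boundaryValue_infty (negFactor_mem_classH hN) h.1).mul
      (tendsto_boundaryValue_infty (posFactor_mem_classH hN) h.2)
    obtain ⟨C, hC⟩ := exists_eventually_im_le h1
    exact ⟨C, hC.mono fun y hy => by rw [eq_negFactor_mul_posFactor hf hf0 hN]; exact hy⟩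

/-- The imaginary part of `logPos` stays in [0, π], so the principal logarithm undoes the
exponential. -/
theorem logPos_im_eq (hN : N.Represents fun z => Complex.log (f z))
    (z : ℍ) : (logPos f N z).im = (Complex.log (posFactor f N z)).im := by
  rw [posFactor, Complex.log_exp]
  · linarith [logPos_im_nonneg (f := f) (N := N) z, Real.pi_pos]
  · exact logPos_im_le hN z

theorem boundaryValue_posFactor_pos (hf : f ∈ classH) (hf0 : f ≠ 0)
    (hN : N.Represents fun z => Complex.log (f z))
    {x : OnePoint ℝ} (hx : x ∈ Omega (posFactor f N)) :
    0 < boundaryValue (posFactor f N) x := by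
  by_contra! hneg
  have hg := posFactor_mem_classH hN
  have hg0 : posFactor f N ≠ 0 := fun h =>
    Complex.exp_ne_zero (logPos f N I) (congrFun h I)
  obtain ⟨y, hy⟩ := exists_boundaryValue_neg hg hg0 hx hneg
  have hlog : ∀ t ∈ realGamma (posFactor f N),
      Tendsto (fun ε => (logPos f N (above t ε)).im) (𝓝[>] 0) (𝓝 Real.pi) := by
    intro t ht
    simp only [logPos_im_eq hN]
    exact tendsto_log_im_of_neg ht.2 (tendsto_boundaryValue hg ht.1) fun _ => hg.2 _
  -- The two imaginary parts have sum at most π, so the one of `logNeg` is squeezed to 0.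
  have hnull : (ofMeasure 0 (N.ρ.restrict (realGamma f))).ρ (realGamma (posFactor f N)) = 0 := by
    refine represents_logNeg.measure_eq_zero fun t ht => ?_
    have h1 : Tendsto (fun ε => Real.pi - (logPos f N (above t ε)).im) (𝓝[>] 0) (𝓝 0) := by
      simpa using (hlog t ht).const_sub Real.pi
    refine squeeze_zero (fun ε => logNeg_im_nonneg _) (fun ε => ?_) h1
    linarith [logNeg_im_add_logPos_im_le hN (above t ε)]
  have hlim : ∀ t ∈ realGamma (posFactor f N), ∃ c : ℝ, c < 0 ∧
      Tendsto (fun ε => f (above t ε)) (𝓝[>] 0) (𝓝 (c : ℂ)) := by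
    intro t ht
    obtain ⟨c, hc0, hc⟩ := tendsto_exp_above represents_logNeg isOpen_realGamma hnull ht
    have h1 := hc.mul (tendsto_boundaryValue hg ht.1)
    rw [← Complex.ofReal_mul] at h1
    exact ⟨_, mul_neg_of_pos_of_neg hc0 ht.2, h1.congr fun ε =>
      (eq_negFactor_mul_posFactor hf hf0 hN _).symm⟩
  -- Real limits of f put these points in Ω(f), and the limits are negative.
  have hsub : realGamma (posFactor f N) ⊆ realGamma f := by
    intro t ht
    have h1 : ((↑) '' realGamma (posFactor f N) : Set (OnePoint ℝ)) ⊆ Omega f := by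
      refine subset_Omega hf (OnePoint.isOpenEmbedding_coe.isOpenMap _ isOpen_realGamma)
        (fun x hx => ?_) fun h => ?_
      · obtain ⟨x', hx', he⟩ := hx
        rw [OnePoint.coe_injective he] at hx'
        obtain ⟨c, -, hc⟩ := hlim x hx'
        exact im_tendsto_zero hc
      · exact absurd h (OnePoint.infty_notMem_image_coe)
    have h2 := h1 (mem_image_of_mem _ ht)
    obtain ⟨c, hc0, hc⟩ := hlim t ht
    have h3 := tendsto_nhds_unique hc (tendsto_boundaryValue hf h2)
    refine ⟨h2, ?_⟩
    rwa [← Complex.ofReal_injective h3]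
  have hnull' : N.ρ (realGamma (posFactor f N)) = 0 := by
    change N.ρ.restrict (realGamma f) _ = 0 at hnull
    rwa [Measure.restrict_apply isOpen_realGamma.measurableSet, inter_eq_left.2 hsub] at hnull
  -- Without mass near y, log f has a real limit at y; yet its imaginary part dominates that of
  -- `logPos`, which tends to π.
  have h1 := im_tendsto_zero (hN.tendsto_above (isOpen_realGamma.mem_nhds hy) hnull')
  have h2 : Real.pi ≤ 0 := by
    refine le_of_tendsto_of_tendsto' (hlog y hy) h1 fun ε => ?_
    simp only [← logNeg_add_logPos hN, Complex.add_im]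
    linarith [logNeg_im_nonneg (f := f) (N := N) (above y ε)]
  exact absurd h2 (not_le.2 Real.pi_pos)

/-- Positivity on Ω(g) makes the measure of `logPos` vanish there, and absolute continuity makes it
ignore the null set U \ Ω(g). So it vanishes on the interior of U, which then lies in Ω(g). -/
theorem isLebesgueRegular_posFactor (hf : f ∈ classH) (hf0 : f ≠ 0)
    (hN : N.Represents fun z => Complex.log (f z))
    : IsLebesgueRegular (Omega (posFactor f N)) := by
  refine ⟨isOpen_Omega, Subset.antisymm ?_ fun x hx =>
    ⟨_, isOpen_Omega.mem_nhds hx, by simp⟩⟩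
  rintro x ⟨U, hU, hvol⟩
  have h1 : (ofMeasure N.β (N.ρ.restrict (realGamma f)ᶜ)).ρ
      ((↑) ⁻¹' Omega (posFactor f N) : Set ℝ) = 0 := by
    refine represents_logPos.measure_eq_zero fun t ht => ?_
    simp only [logPos_im_eq hN]
    exact tendsto_log_im_of_pos (boundaryValue_posFactor_pos hf hf0 hN ht)
      (tendsto_boundaryValue (posFactor_mem_classH hN) ht)
  have h2 : (ofMeasure N.β (N.ρ.restrict (realGamma f)ᶜ)).ρ
      ((↑) ⁻¹' (U \ Omega (posFactor f N)) : Set ℝ) = 0 :=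
    represents_logPos.absolutelyContinuous (logPos_im_le hN) hvol
  refine subset_Omega_exp represents_logPos rfl (logPos_im_le hN) isOpen_interior ?_
    (mem_interior_iff_mem_nhds.2 hU)
  refine measure_mono_null (fun t ht => ?_) (measure_union_null h1 h2)
  by_cases h : (t : OnePoint ℝ) ∈ Omega (posFactor f N)
  · exact Or.inl h
  · exact Or.inr ⟨interior_subset ht, h⟩

theorem measure_complementary_realGamma (hf : f ∈ classH)
    (hN' : N'.Represents fun z => Complex.I * Real.pi - Complex.log (f z)) :
    N'.ρ (realGamma f) = 0 := by
  refine hN'.measure_eq_zero fun x hx => ?_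
  have h := tendsto_log_im_of_neg hx.2 (tendsto_boundaryValue hf hx.1) fun _ => hf.2 _
  simpa using h.const_sub Real.pi

end Parts

/-! ### The factors of a Kreĭn product -/

/-- A measure that dominates a representing measure of `log f` for every `f` in the class: `M`
represents the constant `iπ`, and the measures of `G` and `iπ - G` can be chosen with sum `M`. -/
def IsComplementary (M : Measure ℝ) : Prop :=
  (∃ N : NevanlinnaTriple, N.Represents (fun _ => Complex.I * Real.pi) ∧ N.ρ = M) ∧
    ∀ G : ℍ → ℂ, MDifferentiable 𝓘(ℂ) 𝓘(ℂ) G → (∀ z, 0 ≤ (G z).im) → (∀ z, (G z).im ≤ Real.pi) →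
      ∃ N N' : NevanlinnaTriple, N.Represents G ∧
        N'.Represents (fun z => Complex.I * Real.pi - G z) ∧ N.ρ + N'.ρ = M

variable {M : Measure ℝ}

theorem IsComplementary.exists_log (hM : IsComplementary M) {f : ℍ → ℂ} (hf : f ∈ classH) :
    ∃ N N' : NevanlinnaTriple, N.Represents (fun z => Complex.log (f z)) ∧
      N'.Represents (fun z => Complex.I * Real.pi - Complex.log (f z)) ∧ N.ρ + N'.ρ = M :=
  hM.2 _ (mdifferentiable_log hf) (log_im_nonneg hf) log_im_le_pi

theorem IsComplementary.isFiniteMeasure (hM : IsComplementary M) : IsFiniteMeasure M := by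
  obtain ⟨⟨N, -, rfl⟩, -⟩ := hM
  infer_instance

/-- The kernel at i is constantly i, so the integral is purely imaginary there, and so is αi. -/
theorem β_eq_re {N : NevanlinnaTriple} {f : ℍ → ℂ} (h : N.Represents f) :
    N.β = (f UpperHalfPlane.I).re := by
  rw [h.eq]
  simp [kernel_I]

theorem IsComplementary.integral_kernel (hM : IsComplementary M) (z : ℍ) :
    ∫ t, kernel z t ∂M = Complex.I * Real.pi := by
  obtain ⟨⟨N, hN, rfl⟩, -⟩ := hM
  have hα : N.α = 0 := hN.α_eq_zero (C := Real.pi) (by simp)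
  have hβ : N.β = 0 := by rw [β_eq_re hN]; simp
  have := hN.eq z
  rw [hα, hβ] at this
  simpa using this.symm

theorem restrict_eq_of_add_eq {μ ν : Measure ℝ} (h : μ + ν = M) {s : Set ℝ} (hs : ν s = 0) :
    μ.restrict s = M.restrict s := by
  rw [← h, Measure.restrict_add, Measure.restrict_eq_zero.2 hs, add_zero]

theorem mdifferentiable_of_differentiableOn {p : ℍ → ℂ} {F : ℂ → ℂ}
    (hF : DifferentiableOn ℂ F {z | 0 < z.im}) (hp : ∀ z : ℍ, p z = F z) :
    MDifferentiable 𝓘(ℂ) 𝓘(ℂ) p := by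
  refine UpperHalfPlane.mdifferentiable_iff.2 (hF.congr fun z hz => ?_)
  rw [Function.comp_apply, hp, ofComplex_apply_of_im_pos hz]

/-- A function `p` of the class with `|p(i)| = 1` that extends continuously to the real line except
for countably many points, and is negative on `J` and positive outside, is given by the restriction
of the complementary measure to `J`. -/
theorem IsComplementary.eq_exp_integral (hM : IsComplementary M) {p : ℍ → ℂ} {F : ℂ → ℂ} {q : ℝ → ℝ}
    {J S : Set ℝ} (hF : DifferentiableOn ℂ F {z | 0 < z.im}) (hp : ∀ z : ℍ, p z = F z)
    (him : ∀ z, 0 ≤ (p z).im) (hI : ‖p UpperHalfPlane.I‖ = 1) (hS : S.Countable) (hc : ∀ x, x ∉ S → ContinuousAt F x ∧ F x = q x)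
    (hneg : ∀ x ∈ J, x ∉ S ∧ q x < 0) (hpos : ∀ x, x ∉ J → x ∉ S → 0 < q x) (z : ℍ) :
    p z = Complex.exp (∫ t in J, kernel z t ∂M) := by
  have hpH : p ∈ classH := ⟨mdifferentiable_of_differentiableOn hF hp, him⟩
  have hp0 : p ≠ 0 := by
    rintro rfl
    simp at hI
  obtain ⟨N, N', hN, hN', hadd⟩ := hM.exists_log hpH
  have hlim : ∀ x, x ∉ S → Tendsto (fun ε => p (above x ε)) (𝓝[>] 0) (𝓝 (q x : ℂ)) := by
    intro x hx
    have h := (hc x hx).1.tendsto.comp (tendsto_above x)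
    rw [(hc x hx).2] at h
    exact h.congr fun ε => (hp _).symm
  -- On J the argument tends to π, so the complementary measure is null; off J the argument tends to
  -- 0, so the measure itself is null. Hence it is M restricted to J.
  have h1 : N'.ρ J = 0 := by
    refine hN'.measure_eq_zero fun x hx => ?_
    have h := tendsto_log_im_of_neg (hneg x hx).2 (hlim x (hneg x hx).1) fun _ => him _
    simpa using h.const_sub Real.pi
  have h2 : N.ρ Jᶜ = 0 := by
    have h3 : N.ρ (Jᶜ \ S) = 0 := hN.measure_eq_zero fun x hx =>
      tendsto_log_im_of_pos (hpos x hx.1 hx.2) (hlim x hx.2)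
    have h4 : N.ρ S = 0 := hN.absolutelyContinuous (fun z => log_im_le_pi z) (hS.measure_zero _)
    refine measure_mono_null (fun x hx => ?_) (measure_union_null h3 h4)
    by_cases h : x ∈ S
    · exact Or.inr h
    · exact Or.inl ⟨hx, h⟩
  have h5 : N.ρ = M.restrict J := by
    rw [← restrict_eq_of_add_eq hadd h1, Measure.restrict_eq_self_of_ae_mem]
    exact measure_eq_zero_iff_ae_notMem.1 h2 |>.mono fun x hx => not_not.1 hx
  -- The normalization |p(i)| = 1 enters here: β is log |p(i)|.
  have hβ : N.β = 0 := by
    rw [β_eq_re hN, Complex.log_re, hI, Real.log_one]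
  rw [← h5, ← Complex.exp_log (ne_zero_of_mem_classH hpH hp0 z)]
  congr 1
  have h6 := hN.eq z
  rw [α_eq_zero_of_represents_log hN, hβ] at h6
  simpa using h6

/-! ### Membership in arcs and their real points -/

theorem coe_mem_arc_infty_infty {t : ℝ} : (t : OnePoint ℝ) ∈ arc ∞ ∞ ↔ True := by
  simp [arc]

theorem coe_mem_arc_infty_coe {a t : ℝ} : (t : OnePoint ℝ) ∈ arc ∞ (a : OnePoint ℝ) ↔ t < a := by
  change (t : OnePoint ℝ) ∈ (↑) '' Iio a ↔ _
  simp

theorem coe_mem_arc_coe_infty {b t : ℝ} : (t : OnePoint ℝ) ∈ arc (b : OnePoint ℝ) ∞ ↔ b < t := by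
  change (t : OnePoint ℝ) ∈ (↑) '' Ioi b ↔ _
  simp

theorem coe_mem_arc_coe_coe {b a t : ℝ} : (t : OnePoint ℝ) ∈ arc (b : OnePoint ℝ) (a : OnePoint ℝ) ↔
    if b < a then b < t ∧ t < a else t < a ∨ b < t := by
  change (t : OnePoint ℝ) ∈ (if b < a then (↑) '' Ioo b a else ((↑) '' Icc a b)ᶜ) ↔ _
  split_ifs
  · simp
  · simp only [mem_compl_iff, mem_image, OnePoint.coe_eq_coe, exists_eq_right, mem_Icc, not_and_or,
      not_le]

theorem infty_mem_arc_infty_infty : ∞ ∈ arc ∞ ∞ ↔ False := by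
  simp [arc]

theorem infty_mem_arc_infty_coe {a : ℝ} : ∞ ∈ arc ∞ (a : OnePoint ℝ) ↔ False := by
  change ∞ ∈ ((↑) '' Iio a : Set (OnePoint ℝ)) ↔ _
  simp

theorem infty_mem_arc_coe_infty {b : ℝ} : ∞ ∈ arc (b : OnePoint ℝ) ∞ ↔ False := by
  change ∞ ∈ ((↑) '' Ioi b : Set (OnePoint ℝ)) ↔ _
  simp

theorem infty_mem_arc_coe_coe {b a : ℝ} :
    ∞ ∈ arc (b : OnePoint ℝ) (a : OnePoint ℝ) ↔ ¬ b < a := by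
  change ∞ ∈ (if b < a then (↑) '' Ioo b a else ((↑) '' Icc a b)ᶜ : Set (OnePoint ℝ)) ↔ _
  split_ifs with h <;> simp [h]

/-- The set of the real points of an interval of the circle. -/
def realArc (J : OnePoint ℝ × OnePoint ℝ) : Set ℝ := (↑) ⁻¹' arc J.1 J.2

theorem realArc_infty_infty : realArc (∞, ∞) = univ := by
  ext t; simp [realArc, coe_mem_arc_infty_infty]

theorem realArc_infty_coe (a : ℝ) : realArc (∞, a) = Iio a := by
  ext t; simp [realArc, coe_mem_arc_infty_coe]

theorem realArc_coe_infty (b : ℝ) : realArc (b, ∞) = Ioi b := by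
  ext t; simp [realArc, coe_mem_arc_coe_infty]

theorem realArc_coe_coe_of_lt {b a : ℝ} (h : b < a) : realArc (b, a) = Ioo b a := by
  ext t; simp [realArc, coe_mem_arc_coe_coe, h]

theorem realArc_coe_coe_of_le {b a : ℝ} (h : a ≤ b) : realArc (b, a) = (Icc a b)ᶜ := by
  ext t
  simp only [realArc, mem_preimage, coe_mem_arc_coe_coe, not_lt.2 h, if_false, mem_compl_iff,
    mem_Icc, not_and_or, not_le]

theorem isOpen_realArc (J : OnePoint ℝ × OnePoint ℝ) : IsOpen (realArc J) := by
  obtain ⟨b, a⟩ := J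
  induction b using OnePoint.rec with
  | infty =>
    induction a using OnePoint.rec with
    | infty => simp [realArc_infty_infty]
    | coe a => simpa [realArc_infty_coe] using isOpen_Iio
  | coe b =>
    induction a using OnePoint.rec with
    | infty => simpa [realArc_coe_infty] using isOpen_Ioi
    | coe a =>
      rcases lt_or_ge b a with h | h
      · simpa [realArc_coe_coe_of_lt h] using isOpen_Ioo
      · simpa [realArc_coe_coe_of_le h] using isClosed_Icc

theorem realArc_nonempty (J : OnePoint ℝ × OnePoint ℝ) : (realArc J).Nonempty := by
  obtain ⟨b, a⟩ := J
  induction b using OnePoint.rec with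
  | infty =>
    induction a using OnePoint.rec with
    | infty => simp [realArc_infty_infty]
    | coe a => simp [realArc_infty_coe]
  | coe b =>
    induction a using OnePoint.rec with
    | infty => simp [realArc_coe_infty]
    | coe a =>
      rcases lt_or_ge b a with h | h
      · simpa [realArc_coe_coe_of_lt h] using h
      · exact ⟨a - 1, by simp [realArc_coe_coe_of_le h]⟩

theorem ofReal_sub_ofReal_ne_zero {x b : ℝ} (h : x ≠ b) : (x : ℂ) - b ≠ 0 := by
  rw [← Complex.ofReal_sub, Complex.ofReal_ne_zero]
  exact sub_ne_zero.2 h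

theorem sub_ofReal_ne_zero {z : ℂ} (hz : 0 < z.im) (b : ℝ) : z - b ≠ 0 := by
  rw [← neg_ne_zero, neg_sub]
  exact ofReal_sub_ne_zero hz b

theorem norm_I_sub_pos (a : ℝ) : 0 < ‖Complex.I - (a : ℂ)‖ :=
  norm_pos_iff.2 (sub_ofReal_ne_zero (by simp) a)

theorem moebius_im (z : ℂ) (a b : ℝ) :
    ((z - a) / (z - b)).im = z.im * (a - b) / Complex.normSq (z - b) := by
  rw [Complex.div_im]
  simp
  ring

/-- The factors of a Kreĭn product are given by the complementary measure. -/
theorem IsComplementary.factor_eq (hM : IsComplementary M) (b a : OnePoint ℝ) (z : ℍ) :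
    factor b a z = Complex.exp (∫ t in realArc (b, a), kernel z t ∂M) := by
  induction b using OnePoint.rec with
  | infty =>
    induction a using OnePoint.rec with
    | infty =>
      refine hM.eq_exp_integral (p := factor ∞ ∞) (F := fun _ => -1) (q := fun _ => -1) (S := ∅)
        (by fun_prop) (fun _ => rfl) (fun _ => by simp [factor]) (by simp [factor])
        countable_empty (fun x _ => ⟨continuousAt_const, by simp⟩)
        (fun x _ => ⟨notMem_empty _, by simp⟩) (fun x hx => ?_) z
      rw [realArc_infty_infty] at hx
      exact absurd (mem_univ x) hx
    | coe a =>
      have ha := norm_I_sub_pos a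
      refine hM.eq_exp_integral (p := factor ∞ a) (F := fun z => (z - a) / ‖Complex.I - (a : ℂ)‖)
        (q := fun x => (x - a) / ‖Complex.I - (a : ℂ)‖) (S := {a})
        (by fun_prop) (fun _ => rfl) (fun z => ?_) ?_
        (countable_singleton a) (fun x _ => ⟨by fun_prop, by simp⟩)
        (fun x hx => ?_) (fun x hx hx' => ?_) z
      · change 0 ≤ (((z : ℂ) - a) / ‖Complex.I - (a : ℂ)‖).im
        rw [Complex.div_ofReal_im]
        have : 0 < (z : ℂ).im := z.im_pos
        simp only [Complex.sub_im, Complex.ofReal_im, sub_zero]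
        positivity
      · change ‖((UpperHalfPlane.I : ℂ) - a) / ‖Complex.I - (a : ℂ)‖‖ = 1
        rw [coe_I, norm_div, Complex.norm_real, norm_norm, div_self ha.ne']
      · rw [realArc_infty_coe, mem_Iio] at hx
        exact ⟨by simpa using hx.ne, div_neg_of_neg_of_pos (by linarith) ha⟩
      · rw [realArc_infty_coe, mem_Iio, not_lt] at hx
        exact div_pos (sub_pos.2 (lt_of_le_of_ne hx (Ne.symm hx'))) ha
  | coe b =>
    have hb := norm_I_sub_pos b
    induction a using OnePoint.rec with
    | infty =>
      refine hM.eq_exp_integral (p := factor b ∞)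
        (F := fun z => -(‖Complex.I - (b : ℂ)‖ / (z - b)))
        (q := fun x => -(‖Complex.I - (b : ℂ)‖ / (x - b))) (S := {b})
        (fun z hz => ?_) (fun _ => rfl) (fun z => ?_) ?_
        (countable_singleton b) (fun x hx => ⟨?_, by simp⟩)
        (fun x hx => ?_) (fun x hx hx' => ?_) z
      · have := sub_ofReal_ne_zero hz b
        fun_prop (disch := assumption)
      · change 0 ≤ (-((‖Complex.I - (b : ℂ)‖ : ℂ) / ((z : ℂ) - b))).im
        have hz : 0 < (z : ℂ).im := z.im_pos
        rw [Complex.neg_im, Complex.div_im]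
        have := Complex.normSq_pos.2 (sub_ofReal_ne_zero hz b)
        simp only [Complex.ofReal_im, zero_mul, zero_div, zero_sub, Complex.sub_im, sub_zero,
          Complex.ofReal_re, neg_neg]
        positivity
      · change ‖-((‖Complex.I - (b : ℂ)‖ : ℂ) / ((UpperHalfPlane.I : ℂ) - b))‖ = 1
        rw [coe_I, norm_neg, norm_div, Complex.norm_real, norm_norm, div_self hb.ne']
      · have := ofReal_sub_ofReal_ne_zero hx
        fun_prop (disch := assumption)
      · rw [realArc_coe_infty, mem_Ioi] at hx
        exact ⟨by simpa using hx.ne', neg_neg_of_pos (div_pos hb (by linarith))⟩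
      · rw [realArc_coe_infty, mem_Ioi, not_lt] at hx
        have := lt_of_le_of_ne hx hx'
        exact neg_pos_of_neg (div_neg_of_pos_of_neg hb (by linarith))
    | coe a =>
      have ha := norm_I_sub_pos a
      have hr : 0 < ‖Complex.I - (b : ℂ)‖ / ‖Complex.I - (a : ℂ)‖ := div_pos hb ha
      have hnorm : ‖(((‖Complex.I - (b : ℂ)‖ / ‖Complex.I - (a : ℂ)‖ : ℝ) : ℂ) *
          ((Complex.I - a) / (Complex.I - b)))‖ = 1 := by
        rw [norm_mul, Complex.norm_real, Real.norm_of_nonneg hr.le, norm_div]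
        field_simp
      have hdiff : DifferentiableOn ℂ (fun z => ((‖Complex.I - (b : ℂ)‖ / ‖Complex.I - (a : ℂ)‖ : ℝ)
          : ℂ) * ((z - a) / (z - b))) {z : ℂ | 0 < z.im} := fun z hz => by
        have := sub_ofReal_ne_zero hz b
        fun_prop (disch := assumption)
      have hcont : ∀ x : ℝ, x ∉ ({a, b} : Set ℝ) → ContinuousAt
          (fun z => ((‖Complex.I - (b : ℂ)‖ / ‖Complex.I - (a : ℂ)‖ : ℝ)
          : ℂ) * ((z - a) / (z - b))) (x : ℂ) := fun x hx => by
        have := ofReal_sub_ofReal_ne_zero (x := x) (b := b) (by rintro rfl; simp at hx)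
        fun_prop (disch := assumption)
      have him : ∀ z : ℍ, (((‖Complex.I - (b : ℂ)‖ / ‖Complex.I - (a : ℂ)‖ : ℝ) : ℂ) *
          (((z : ℂ) - a) / ((z : ℂ) - b))).im = (‖Complex.I - (b : ℂ)‖ / ‖Complex.I - (a : ℂ)‖) *
          ((z : ℂ).im / Complex.normSq (z - b)) * (a - b) := fun z => by
        rw [Complex.im_ofReal_mul, moebius_im]
        ring
      have hnn : ∀ z : ℍ, 0 ≤ (‖Complex.I - (b : ℂ)‖ / ‖Complex.I - (a : ℂ)‖) *
          ((z : ℂ).im / Complex.normSq (z - b)) := fun z =>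
        mul_nonneg hr.le (div_nonneg z.im_pos.le (Complex.normSq_nonneg _))
      generalize hR : ‖Complex.I - (b : ℂ)‖ / ‖Complex.I - (a : ℂ)‖ = r at *
      have hfac : ∀ z : ℍ, factor b a z = if b < a then (r : ℂ) * (((z : ℂ) - a) / ((z : ℂ) - b))
          else -((r : ℂ) * (((z : ℂ) - a) / ((z : ℂ) - b))) := fun z => by
        rw [← hR]
        rfl
      rcases lt_or_ge b a with h | h
      · simp only [h, if_true] at hfac
        refine hM.eq_exp_integral (p := factor b a) (q := fun x => r * ((x - a) / (x - b)))
          (S := {a, b}) hdiff hfac (fun z => ?_) ?_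
          (by simp) (fun x hx => ⟨hcont x hx, by simp⟩)
          (fun x hx => ?_) (fun x hx hx' => ?_) z
        · rw [hfac, him]
          exact mul_nonneg (hnn z) (by linarith)
        · rw [hfac, coe_I, hnorm]
        · rw [realArc_coe_coe_of_lt h] at hx
          refine ⟨by simp [hx.2.ne, hx.1.ne'], mul_neg_of_pos_of_neg hr ?_⟩
          exact div_neg_of_neg_of_pos (by linarith [hx.2]) (by linarith [hx.1])
        · rw [realArc_coe_coe_of_lt h, mem_Ioo, not_and_or, not_lt, not_lt] at hx
          simp only [mem_insert_iff, mem_singleton_iff, not_or] at hx'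
          refine mul_pos hr ?_
          rcases hx with hx | hx
          · have := lt_of_le_of_ne hx hx'.2
            exact div_pos_of_neg_of_neg (by linarith) (by linarith)
          · have := lt_of_le_of_ne hx (Ne.symm hx'.1)
            exact div_pos (by linarith) (by linarith)
      -- This includes a = b, where the real points are the complement of one point.
      · simp only [not_lt.2 h, if_false] at hfac
        refine hM.eq_exp_integral (p := factor b a) (q := fun x => -(r * ((x - a) / (x - b))))
          (S := {a, b}) hdiff.neg hfac (fun z => ?_) ?_
          (by simp) (fun x hx => ⟨(hcont x hx).neg, by simp⟩)
          (fun x hx => ?_) (fun x hx hx' => ?_) z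
        · rw [hfac, Complex.neg_im, him]
          have := mul_nonneg (hnn z) (by linarith : 0 ≤ b - a)
          linarith
        · rw [hfac, coe_I, norm_neg, hnorm]
        · rw [realArc_coe_coe_of_le h, mem_compl_iff, mem_Icc, not_and_or, not_le, not_le] at hx
          rcases hx with hx | hx
          · refine ⟨by simp [hx.ne, (hx.trans_le h).ne], neg_neg_of_pos (mul_pos hr ?_)⟩
            exact div_pos_of_neg_of_neg (by linarith) (by linarith)
          · refine ⟨by simp [hx.ne', (h.trans_lt hx).ne'], neg_neg_of_pos (mul_pos hr ?_)⟩
            exact div_pos (by linarith) (by linarith)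
        · rw [realArc_coe_coe_of_le h, notMem_compl_iff] at hx
          simp only [mem_insert_iff, mem_singleton_iff, not_or] at hx'
          have h1 := lt_of_le_of_ne hx.1 (Ne.symm hx'.1)
          have h2 := lt_of_le_of_ne hx.2 hx'.2
          exact neg_pos_of_neg (mul_neg_of_pos_of_neg hr
            (div_neg_of_pos_of_neg (by linarith) (by linarith)))

/-! ### The components of an open set -/

variable {O : Set (OnePoint ℝ)}

/-- Neither arc contains an endpoint of the other, since arcs lie in O and endpoints do not. With a
common real point, comparing endpoints in the order of ℝ forces equality. -/
theorem eq_of_mem_realArc {J J' : OnePoint ℝ × OnePoint ℝ} (hJ : J ∈ components O)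
    (hJ' : J' ∈ components O) {x : ℝ} (hx : x ∈ realArc J) (hx' : x ∈ realArc J') : J = J' := by
  obtain ⟨h1, h2, h3⟩ := hJ
  obtain ⟨h1', h2', h3'⟩ := hJ'
  have e1 := fun h => h2' (h1 h)
  have e2 := fun h => h3' (h1 h)
  have e3 := fun h => h2 (h1' h)
  have e4 := fun h => h3 (h1' h)
  clear h1 h1' h2 h2' h3 h3'
  obtain ⟨b, a⟩ := J
  obtain ⟨b', a'⟩ := J'
  simp only [realArc, mem_preimage] at hx hx' e1 e2 e3 e4
  induction b using OnePoint.rec <;> induction a using OnePoint.rec <;>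
    induction b' using OnePoint.rec <;> induction a' using OnePoint.rec <;>
    simp only [coe_mem_arc_infty_infty, coe_mem_arc_infty_coe, coe_mem_arc_coe_infty,
      coe_mem_arc_coe_coe, infty_mem_arc_infty_infty, infty_mem_arc_infty_coe,
      infty_mem_arc_coe_infty, infty_mem_arc_coe_coe] at hx hx' e1 e2 e3 e4 <;> grind

/-- Moving right from x, one meets the complement of O at a first real point, or is stopped at ∞, or
passes through ∞ and continues from -∞ to the least real point of the complement. In the last case
this complement is bounded because O is a neighbourhood of ∞. -/
theorem exists_right_end (hO : IsOpen O) (hne : O ≠ univ) {x : ℝ} (hx : (x : OnePoint ℝ) ∈ O) :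
    (∃ a : ℝ, x < a ∧ (a : OnePoint ℝ) ∉ O ∧ ∀ t : ℝ, x ≤ t → t < a → (t : OnePoint ℝ) ∈ O) ∨
    (∞ ∉ O ∧ ∀ t : ℝ, x ≤ t → (t : OnePoint ℝ) ∈ O) ∨
    (∞ ∈ O ∧ (∀ t : ℝ, x ≤ t → (t : OnePoint ℝ) ∈ O) ∧
      ∃ a : ℝ, (a : OnePoint ℝ) ∉ O ∧ ∀ t : ℝ, t < a → (t : OnePoint ℝ) ∈ O) := by
  have hcl : IsClosed {t : ℝ | (t : OnePoint ℝ) ∉ O} :=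
    (hO.preimage OnePoint.continuous_coe).isClosed_compl
  by_cases h : ∃ t : ℝ, x ≤ t ∧ (t : OnePoint ℝ) ∉ O
  · left
    have hbdd : BddBelow {t : ℝ | x ≤ t ∧ (t : OnePoint ℝ) ∉ O} := ⟨x, fun t ht => ht.1⟩
    have hmem := (isClosed_Ici.inter hcl : IsClosed {t : ℝ | x ≤ t ∧ (t : OnePoint ℝ) ∉ O}).csInf_mem
      h hbdd
    refine ⟨_, lt_of_le_of_ne hmem.1 fun he => hmem.2 (he ▸ hx), hmem.2, fun t ht hta => ?_⟩
    by_contra hn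
    exact absurd (csInf_le hbdd ⟨ht, hn⟩) (not_le.2 hta)
  · push Not at h
    by_cases hinf : ∞ ∈ O
    · right; right
      refine ⟨hinf, h, ?_⟩
      have hK : {t : ℝ | (t : OnePoint ℝ) ∉ O}.Nonempty := by
        obtain ⟨c, hc⟩ := (ne_univ_iff_exists_notMem _).1 hne
        induction c using OnePoint.rec with
        | infty => exact absurd hinf hc
        | coe c => exact ⟨c, hc⟩
      have hbdd : BddBelow {t : ℝ | (t : OnePoint ℝ) ∉ O} :=
        ((OnePoint.isOpen_def.1 hO).1 hinf).bddBelow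
      refine ⟨_, hcl.csInf_mem hK hbdd, fun t ht => ?_⟩
      by_contra hn
      exact absurd (csInf_le hbdd hn) (not_le.2 ht)
    · exact Or.inr (Or.inl ⟨hinf, h⟩)

theorem exists_left_end (hO : IsOpen O) (hne : O ≠ univ) {x : ℝ} (hx : (x : OnePoint ℝ) ∈ O) :
    (∃ b : ℝ, b < x ∧ (b : OnePoint ℝ) ∉ O ∧ ∀ t : ℝ, t ≤ x → b < t → (t : OnePoint ℝ) ∈ O) ∨
    (∞ ∉ O ∧ ∀ t : ℝ, t ≤ x → (t : OnePoint ℝ) ∈ O) ∨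
    (∞ ∈ O ∧ (∀ t : ℝ, t ≤ x → (t : OnePoint ℝ) ∈ O) ∧
      ∃ b : ℝ, (b : OnePoint ℝ) ∉ O ∧ ∀ t : ℝ, b < t → (t : OnePoint ℝ) ∈ O) := by
  have hcl : IsClosed {t : ℝ | (t : OnePoint ℝ) ∉ O} :=
    (hO.preimage OnePoint.continuous_coe).isClosed_compl
  by_cases h : ∃ t : ℝ, t ≤ x ∧ (t : OnePoint ℝ) ∉ O
  · left
    have hbdd : BddAbove {t : ℝ | t ≤ x ∧ (t : OnePoint ℝ) ∉ O} := ⟨x, fun t ht => ht.1⟩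
    have hmem := (isClosed_Iic.inter hcl : IsClosed {t : ℝ | t ≤ x ∧ (t : OnePoint ℝ) ∉ O}).csSup_mem
      h hbdd
    refine ⟨_, lt_of_le_of_ne hmem.1 fun he => hmem.2 (by rw [he]; exact hx), hmem.2, fun t ht hta => ?_⟩
    by_contra hn
    exact absurd (le_csSup hbdd ⟨ht, hn⟩) (not_le.2 hta)
  · push Not at h
    by_cases hinf : ∞ ∈ O
    · right; right
      refine ⟨hinf, h, ?_⟩
      have hK : {t : ℝ | (t : OnePoint ℝ) ∉ O}.Nonempty := by
        obtain ⟨c, hc⟩ := (ne_univ_iff_exists_notMem _).1 hne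
        induction c using OnePoint.rec with
        | infty => exact absurd hinf hc
        | coe c => exact ⟨c, hc⟩
      have hbdd : BddAbove {t : ℝ | (t : OnePoint ℝ) ∉ O} :=
        ((OnePoint.isOpen_def.1 hO).1 hinf).bddAbove
      refine ⟨_, hcl.csSup_mem hK hbdd, fun t ht => ?_⟩
      by_contra hn
      exact absurd (le_csSup hbdd hn) (not_le.2 ht)
    · exact Or.inr (Or.inl ⟨hinf, h⟩)

/-- Every real point of an open set that is not the whole circle lies in a component. -/
theorem exists_component (hO : IsOpen O) (hne : O ≠ univ) {x : ℝ} (hx : (x : OnePoint ℝ) ∈ O) :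
    ∃ J ∈ components O, x ∈ realArc J := by
  -- The component passing through ∞, which may be reached from x in either direction; a = b is
  -- allowed.
  have hwrap : ∀ a b : ℝ, (a : OnePoint ℝ) ∉ O → (b : OnePoint ℝ) ∉ O → ∞ ∈ O →
      (∀ t : ℝ, t < a → (t : OnePoint ℝ) ∈ O) → (∀ t : ℝ, b < t → (t : OnePoint ℝ) ∈ O) →
      x < a ∨ b < x → ∃ J ∈ components O, x ∈ realArc J := by
    intro a b ha hb hinf h1 h2 h3
    have hab : a ≤ b := not_lt.1 fun h => ha (h2 a h)
    refine ⟨(b, a), ⟨fun t ht => ?_, hb, ha⟩, ?_⟩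
    · induction t using OnePoint.rec with
      | infty => exact hinf
      | coe t =>
        rw [coe_mem_arc_coe_coe, if_neg (not_lt.2 hab)] at ht
        exact ht.elim (h1 t) (h2 t)
    · rw [realArc, mem_preimage, coe_mem_arc_coe_coe, if_neg (not_lt.2 hab)]
      exact h3
  rcases exists_right_end hO hne hx with ⟨a, hxa, ha, hr⟩ | ⟨hinf, hr⟩ | ⟨hinf, hr, a, ha, hr'⟩ <;>
    rcases exists_left_end hO hne hx with ⟨b, hbx, hb, hl⟩ | ⟨hinf', hl⟩ | ⟨hinf', hl, b, hb, hl'⟩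
  · have hba := hbx.trans hxa
    refine ⟨(b, a), ⟨fun t ht => ?_, hb, ha⟩, ?_⟩
    · induction t using OnePoint.rec with
      | infty => exact absurd hba (infty_mem_arc_coe_coe.1 ht)
      | coe t =>
        rw [coe_mem_arc_coe_coe, if_pos hba] at ht
        exact (le_total x t).elim (fun h => hr t h ht.2) fun h => hl t h ht.1
    · rw [realArc_coe_coe_of_lt hba]
      exact ⟨hbx, hxa⟩
  · refine ⟨(∞, a), ⟨fun t ht => ?_, hinf', ha⟩, ?_⟩
    · induction t using OnePoint.rec with
      | infty => exact (infty_mem_arc_infty_coe.1 ht).elim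
      | coe t =>
        rw [coe_mem_arc_infty_coe] at ht
        exact (le_total x t).elim (fun h => hr t h ht) fun h => hl t h
    · rw [realArc_infty_coe]
      exact hxa
  · exact hwrap a b ha hb hinf'
      (fun t ht => (le_total x t).elim (fun h => hr t h ht) fun h => hl t h) hl' (Or.inl hxa)
  · refine ⟨(b, ∞), ⟨fun t ht => ?_, hb, hinf⟩, ?_⟩
    · induction t using OnePoint.rec with
      | infty => exact (infty_mem_arc_coe_infty.1 ht).elim
      | coe t =>
        rw [coe_mem_arc_coe_infty] at ht
        exact (le_total x t).elim (fun h => hr t h) fun h => hl t h ht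
    · rw [realArc_coe_infty]
      exact hbx
  · refine ⟨(∞, ∞), ⟨fun t ht => ?_, hinf, hinf⟩, ?_⟩
    · induction t using OnePoint.rec with
      | infty => exact (infty_mem_arc_infty_infty.1 ht).elim
      | coe t => exact (le_total x t).elim (fun h => hr t h) fun h => hl t h
    · rw [realArc_infty_infty]
      exact mem_univ x
  · exact absurd hinf' hinf
  · exact hwrap a b ha hb hinf hr'
      (fun t ht => (le_total x t).elim (fun h => hr t h) fun h => hl t h ht) (Or.inr hbx)
  · exact absurd hinf hinf'
  -- Reaching ∞ inside O in both directions would put every real point in O, including a.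
  · exact absurd ((le_total x a).elim (fun h => hr a h) fun h => hl a h) ha

theorem iUnion_realArc (hO : IsOpen O) (hne : O ≠ univ) :
    ⋃ J : components O, realArc J = ((↑) ⁻¹' O : Set ℝ) := by
  ext x
  simp only [mem_iUnion, mem_preimage]
  constructor
  · rintro ⟨J, hJ⟩
    exact J.2.1 hJ
  · intro hx
    obtain ⟨J, hJ, hxJ⟩ := exists_component hO hne hx
    exact ⟨⟨J, hJ⟩, hxJ⟩

theorem pairwise_disjoint_realArc :
    Pairwise (Function.onFun Disjoint fun J : components O => realArc J) := by
  intro J J' hJJ'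
  rw [Function.onFun, Set.disjoint_left]
  intro x hx hx'
  exact hJJ' (Subtype.ext (eq_of_mem_realArc J.2 J'.2 hx hx'))

theorem countable_components (O : Set (OnePoint ℝ)) : Countable (components O) :=
  pairwise_disjoint_realArc.countable_of_isOpen_disjoint (fun _ => isOpen_realArc _)
    fun _ => realArc_nonempty _

/-- The integral is countably additive over the disjoint components, and the exponential turns the
unconditional sum into an unconditional product. -/
theorem IsComplementary.hasProd_factor (hM : IsComplementary M) (hO : IsOpen O) (hne : O ≠ univ)
    (z : ℍ) : HasProd (fun J : components O => factor J.1.1 J.1.2 z)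
      (Complex.exp (∫ t in ((↑) ⁻¹' O : Set ℝ), kernel z t ∂M)) := by
  have := hM.isFiniteMeasure
  have := countable_components O
  have h := hasSum_integral_iUnion (μ := M) (f := kernel z)
    (fun J : components O => (isOpen_realArc J).measurableSet) pairwise_disjoint_realArc
    (integrable_kernel M z.im_pos).integrableOn
  rw [iUnion_realArc hO hne] at h
  exact h.cexp.congr_fun fun J => hM.factor_eq _ _ z

theorem components_univ : components univ = ∅ := by
  rw [eq_empty_iff_forall_notMem]
  exact fun J hJ => hJ.2.1 (mem_univ _)

theorem IsComplementary.multipliable_factor (hM : IsComplementary M) (hO : IsOpen O) (z : ℍ) :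
    Multipliable fun J : components O => factor J.1.1 J.1.2 z := by
  by_cases h : O = univ
  · subst h
    have : IsEmpty (components univ) := by
      rw [components_univ]
      infer_instance
    exact multipliable_empty
  · exact (hM.hasProd_factor hO h z).multipliable

theorem IsComplementary.kreinProduct_eq (hM : IsComplementary M) (hO : IsOpen O) (z : ℍ) :
    kreinProduct O z = Complex.exp (∫ t in ((↑) ⁻¹' O : Set ℝ), kernel z t ∂M) := by
  rw [kreinProduct]
  split_ifs with h
  -- The whole circle has no endpoints, so the indexed product would be 1; the prescribed value -1
  -- is exp(iπ), in agreement with the total integral iπ.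
  · rw [h, preimage_univ, Measure.restrict_univ, hM.integral_kernel, mul_comm, Complex.exp_pi_mul_I]
  · exact (hM.hasProd_factor hO h z).tprod_eq

end KreinFactorization

end

/-! ### The factorization theorem -/

open KreinFactorization in
theorem mainTheorem1 (f : ℍ → ℂ) (hf : f ∈ classH) (hf0 : f ≠ 0) :
    (∀ z : ℍ, Multipliable fun J : components (Gamma f) => factor J.1.1 J.1.2 z) ∧
    kreinProduct (Gamma f) ∈ classH ∧
    ∃ g ∈ classH,
      (∀ z : ℍ, f z = kreinProduct (Gamma f) z * g z) ∧
      sigma g ⊆ sigma f ∧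
      (∀ x ∈ Omega g, 0 < boundaryValue g x) ∧
      IsLebesgueRegular (Omega g) ∧
      Omega f = Omega (kreinProduct (Gamma f)) ∩ Omega g := by
  obtain ⟨M, -, hM⟩ := exists_complementary_measures
  replace hM : IsComplementary M := hM
  obtain ⟨N, N', hN, hN', hadd⟩ := hM.exists_log hf
  -- The measure of iπ - log f vanishes on Γ(f), so there the measure of log f may be replaced by M.
  have hk : kreinProduct (Gamma f) = negFactor f N := by
    ext z
    rw [hM.kreinProduct_eq isOpen_Gamma, negFactor, logNeg,
      restrict_eq_of_add_eq hadd (measure_complementary_realGamma hf hN')]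
    rfl
  refine ⟨hM.multipliable_factor isOpen_Gamma, hk ▸ negFactor_mem_classH hN, posFactor f N,
    posFactor_mem_classH hN, fun z => ?_, ?_, fun x hx => boundaryValue_posFactor_pos hf hf0 hN hx,
    isLebesgueRegular_posFactor hf hf0 hN, ?_⟩
  · rw [hk, eq_negFactor_mul_posFactor hf hf0 hN]
  · exact compl_subset_compl.1 (Omega_subset_Omega_posFactor hf hf0 hN)
  · rw [hk, ← Omega_eq_inter hf hf0 hN]
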